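/- \textbf{Setting.} A $\Gamma$-set is a functor from the category $\Gamma^{\rm op}$ of finite pointed sets $k_+=\{*,1,\dots,k\}$ to pointed sets that preserves the zero object; an $\mathbb S$-algebra is a monoid, and a module over it a module, for the smash (Day convolution) product $\wedge$ of $\Gamma$-sets. For an abelian group $E$, $HE(k_+)=E^k$. Let $\overline{\operatorname{Spec}\mathbb Z}=\operatorname{Spec}\mathbb Z\cup\{\infty\}$, whose non-empty open sets are the complements of finite sets $F$ of points not containing the generic point. For an Arakelov divisor $D=(D_{\rm finite},a)$, with $D_{\rm finite}=\sum_p n_p\,p$ a divisor on $\operatorname{Spec}\mathbb Z$ and $a\in\mathbb R$, and for a non-empty open $U$, put $$E_D(U)=\{q\in\mathbb Q : q=0\ \text{or}\ \operatorname{ord}_p(q)+n_p\ge 0\ \text{for all primes } p\in U\},$$ and let $\mathcal O(D)(U)\subset H\mathbb Q$ be $HE_D(U)$ if $\infty\notin U$, and $$\mathcal O(D)(U)(k_+)=\Big\{\phi\in E_D(U)^k : \sum_i|\phi(i)|\le e^a\Big\}\quad\text{if }\infty\in U.$$ (All sections over $\emptyset$ are trivial.) The structure sheaf is $\mathcal O=\mathcal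 O(0)$, a sheaf of commutative $\mathbb S$-algebras with the product of $\mathbb Q$; every $\mathcal O(D)$ is a sheaf of $\mathcal O$-modules. Let $\mathcal O_\epsilon$ be the sheaf of $\mathcal O$-modules defined like $\mathcal O(0)$, with the condition $\sum_i|\phi(i)|<1$ if $\infty\in U$. For sheaves $M,N$ of $\mathcal O$-modules, $M\wedge_{\mathcal O}N$ is the sheaf associated to $U\mapsto M(U)\wedge_{\mathcal O(U)}N(U)$, where $M\wedge_AN$ is the coequalizer of $M\wedge A\wedge N\rightrightarrows M\wedge N$. The principal divisor of $q\in\mathbb Q^\times$ is $(q)=\big(\sum_p\operatorname{ord}_p(q)\,p,\,-\log|q|\big)$. \textbf{Proposition.} Let $D=(D_{\rm finite},a)$ and $D'=(D'_{\rm finite},a')$ be Arakelov divisors on $\overline{\operatorname{Spec}\mathbb Z}$. (i) Unless $e^a$ and $e^{a'}$ are both irrational while $e^ae^{a'}$ is rational, the morphism $\mathcal O(D)\wedge_{\mathcal O}\mathcal O(D')\to\mathcal O(D+D')$ induced by the product of $\mathbb Q$ is an isomorphism of sheaves of $\mathcal O$-modules. In the exceptional case $\mathcal O(D)\wedge_{\mathcal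 O}\mathcal O(D')$ is not isomorphic to $\mathcal O(D+D')$ as a sheaf of $\mathcal O$-modules, and there are isomorphisms of sheaves of $\mathcal O$-modules $$\mathcal O(D)\wedge_{\mathcal O}\mathcal O(D')\simeq\mathcal O_\epsilon\wedge_{\mathcal O}\mathcal O(D+D')\simeq\mathcal O(D+D')\wedge_{\mathcal O}\mathcal O_\epsilon .$$ (ii) $D'-D=(q)$ for some $q\in\mathbb Q^\times$ if and only if $\mathcal O(D)$ and $\mathcal O(D')$ are isomorphic as sheaves of $\mathcal O$-modules. -/

import Mathlib

open CategoryTheory TopologicalSpace Opposite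

namespace GammaArith

/-! ## The category of finite pointed sets `k₊` -/

/-- Objects of `Γᵒᵖ`: the object `⟨k⟩` is the finite pointed set `k₊ = {*, 1, …, k}`. -/
structure GammaOp where
  /-- the number of points different from the base point -/
  card : ℕ

/-- The underlying set of `k₊`; the base point is `none`. -/
abbrev GammaOp.Pt (k : GammaOp) : Type := Option (Fin k.card)

/-- Maps of finite pointed sets. -/
@[ext]
structure PMap (m n : GammaOp) where
  /-- the underlying map -/
  toFun : m.Pt → n.Pt
  map_none : toFun none = none

instance : Category GammaOp where
  Hom := PMap
  id _ := ⟨fun x => x, rfl⟩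
  comp f g := ⟨fun x => g.toFun (f.toFun x), by rw [f.map_none, g.map_none]⟩

@[simp] theorem PMap.id_toFun (m : GammaOp) (x : m.Pt) : PMap.toFun (𝟙 m) x = x := rfl

@[simp] theorem PMap.comp_toFun {m n k : GammaOp} (f : m ⟶ n) (g : n ⟶ k) (x : m.Pt) :
    PMap.toFun (f ≫ g) x = PMap.toFun g (PMap.toFun f x) := rfl

/-- Pointed maps `m₊ ∧ n₊ → k₊`, given as maps on `m₊ × n₊` that send
`m₊ × {*} ∪ {*} × n₊` to the base point. -/
@[ext]
structure SmashMap (m n k : GammaOp) where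
  /-- the underlying map -/
  toFun : m.Pt → n.Pt → k.Pt
  left_none : ∀ y, toFun none y = none
  right_none : ∀ x, toFun x none = none

namespace SmashMap

/-- The composite `m₊ ∧ n₊ → m'₊ ∧ n'₊ → k₊`. -/
def pre {m n m' n' k : GammaOp} (v : SmashMap m' n' k) (f : m ⟶ m') (g : n ⟶ n') :
    SmashMap m n k where
  toFun x y := v.toFun (PMap.toFun f x) (PMap.toFun g y)
  left_none y := by rw [PMap.map_none, v.left_none]
  right_none x := by rw [PMap.map_none, v.right_none]

/-- The composite `m₊ ∧ n₊ → k₊ → k'₊`. -/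
def post {m n k k' : GammaOp} (v : SmashMap m n k) (h : k ⟶ k') : SmashMap m n k' where
  toFun x y := PMap.toFun h (v.toFun x y)
  left_none y := by rw [v.left_none, PMap.map_none]
  right_none x := by rw [v.right_none, PMap.map_none]

/-- The composite of `v` with the exchange `n₊ ∧ m₊ → m₊ ∧ n₊`. -/
def swap {m n k : GammaOp} (v : SmashMap m n k) : SmashMap n m k where
  toFun y x := v.toFun x y
  left_none y := v.right_none y
  right_none x := v.left_none x

/-- The pointed map `v (x, -)`. -/
def slice {m n k : GammaOp} (v : SmashMap m n k) (x : m.Pt) : n ⟶ k :=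
  ⟨fun y => v.toFun x y, v.right_none x⟩

/-- The identification `m₊ ∧ n₊ ≃ (m n)₊`. -/
def univ (m n : GammaOp) : SmashMap m n ⟨m.card * n.card⟩ where
  toFun x y := x.bind fun i => y.map fun j => finProdFinEquiv (i, j)
  left_none y := rfl
  right_none x := by cases x <;> rfl

/-- The map `(m n)₊ → k₊` corresponding to a map `m₊ ∧ n₊ → k₊`. -/
def lift {m n k : GammaOp} (v : SmashMap m n k) : (⟨m.card * n.card⟩ : GammaOp) ⟶ k :=
  ⟨fun z => z.bind fun i =>
    v.toFun (some (finProdFinEquiv.symm i).1) (some (finProdFinEquiv.symm i).2), rfl⟩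

theorem some_eq_univ {m n : GammaOp} (z : Fin (m.card * n.card)) :
    (some z : GammaOp.Pt ⟨m.card * n.card⟩) = (univ m n).toFun
      (some (finProdFinEquiv.symm z).1) (some (finProdFinEquiv.symm z).2) := by
  simp [univ, -finProdFinEquiv_symm_apply]

theorem lift_univ {m n k : GammaOp} (v : SmashMap m n k) (x : m.Pt) (y : n.Pt) :
    PMap.toFun v.lift ((univ m n).toFun x y) = v.toFun x y := by
  cases x with
  | none => simp [univ, lift, v.left_none]
  | some i => cases y with
    | none => simp [univ, lift, v.right_none]
    | some j => simp [univ, lift, -finProdFinEquiv_symm_apply]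

theorem univ_post_lift {m n k : GammaOp} (v : SmashMap m n k) : (univ m n).post v.lift = v := by
  ext1; funext x y; exact lift_univ v x y

end SmashMap

/-- For a map `w : l₊ ∧ k₊ → k'₊` and a map `v : m₊ ∧ n₊ → k₊`, the map
`(l₊ ∧ m₊) ∧ n₊ ≃ l₊ ∧ (m₊ ∧ n₊) → k'₊`, `(c ∧ x) ∧ y ↦ w (c, v (x, y))`. -/
def SmashMap.assoc {l m n k k' : GammaOp} (w : SmashMap l k k') (v : SmashMap m n k) :
    SmashMap ⟨l.card * m.card⟩ n k' where
  toFun z y := z.bind fun i => w.toFun (some (finProdFinEquiv.symm i).1)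
    (v.toFun (some (finProdFinEquiv.symm i).2) y)
  left_none y := rfl
  right_none x := by cases x <;> simp [v.right_none, w.right_none]

theorem SmashMap.assoc_univ {l m n k k' : GammaOp} (w : SmashMap l k k') (v : SmashMap m n k)
    (c : l.Pt) (x : m.Pt) (y : n.Pt) :
    (w.assoc v).toFun ((univ l m).toFun c x) y = w.toFun c (v.toFun x y) := by
  cases c with
  | none => simp [univ, assoc, w.left_none]
  | some i => cases x with
    | none => simp [univ, assoc, v.left_none, w.right_none]
    | some j => simp [univ, assoc, -finProdFinEquiv_symm_apply]

/-! ## Γ-sets, `𝕊`-algebras and modules -/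

/-- A Γ-set: a functor from `Γᵒᵖ` to pointed sets that preserves the zero object. -/
structure GammaSet extends GammaOp ⥤ Pointed.{0} where
  subsingleton_zero : Subsingleton (obj ⟨0⟩)

/-- The map `M(f)` on elements. -/
abbrev GammaSet.mp (M : GammaSet) {m n : GammaOp} (f : m ⟶ n) (x : M.obj m) : M.obj n :=
  Pointed.Hom.toFun (M.map f) x

theorem GammaSet.mp_id (M : GammaSet) {m : GammaOp} (x : M.obj m) : M.mp (𝟙 m) x = x := by
  unfold GammaSet.mp; rw [M.map_id]; rfl

theorem GammaSet.mp_comp (M : GammaSet) {m n k : GammaOp} (f : m ⟶ n) (g : n ⟶ k) (x : M.obj m) :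
    M.mp (f ≫ g) x = M.mp g (M.mp f x) := by
  unfold GammaSet.mp; rw [M.map_comp]; rfl

theorem GammaSet.mp_point (M : GammaSet) {m n : GammaOp} (f : m ⟶ n) :
    M.mp f (M.obj m).point = (M.obj n).point := Pointed.Hom.map_point _

/-- A morphism of Γ-sets (a natural transformation) on elements. -/
abbrev evalAt {F G : GammaOp ⥤ Pointed.{0}} (φ : F ⟶ G) {n : GammaOp} (x : F.obj n) : G.obj n :=
  Pointed.Hom.toFun (φ.app n) x

theorem evalAt_map {F G : GammaOp ⥤ Pointed.{0}} (φ : F ⟶ G) {m n : GammaOp} (f : m ⟶ n)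
    (x : F.obj m) :
    evalAt φ (Pointed.Hom.toFun (F.map f) x) = Pointed.Hom.toFun (G.map f) (evalAt φ x) :=
  congrFun (congrArg Pointed.Hom.toFun (φ.naturality f)) x

/-- The Γ-set `𝕊`: the inclusion of `Γᵒᵖ` into pointed sets. -/
def sphere : GammaSet where
  obj n := Pointed.of (none : n.Pt)
  map f := ⟨f.toFun, f.map_none⟩
  subsingleton_zero := ⟨fun a b => by
    rcases a with _ | a
    · rcases b with _ | b
      · rfl
      · exact b.elim0
    · exact a.elim0⟩

/-- A commutative `𝕊`-algebra. The multiplication `A ∧ A → A` is given, through the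
universal property of the colimit defining the smash product of Γ-sets, by maps
`A(m₊) × A(n₊) → A(k₊)` for all pointed maps `v : m₊ ∧ n₊ → k₊`, natural in `m₊, n₊, k₊`. -/
structure CommSAlg extends GammaSet where
  /-- the unit `𝕊 → A` -/
  one : sphere.toFunctor ⟶ toFunctor
  /-- the multiplication `A ∧ A → A` -/
  mul : ∀ {m n k : GammaOp}, obj m → obj n → SmashMap m n k → obj k
  mul_map : ∀ {m n m' n' k : GammaOp} (f : m ⟶ m') (g : n ⟶ n') (v : SmashMap m' n' k)
    (a : obj m) (b : obj n),
    mul (toGammaSet.mp f a) (toGammaSet.mp g b) v = mul a b (v.pre f g)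
  map_mul : ∀ {m n k k' : GammaOp} (v : SmashMap m n k) (h : k ⟶ k') (a : obj m) (b : obj n),
    toGammaSet.mp h (mul a b v) = mul a b (v.post h)
  one_mul : ∀ {m n k : GammaOp} (v : SmashMap m n k) (c : m.Pt) (b : obj n),
    mul (evalAt one c) b v = toGammaSet.mp (v.slice c) b
  mul_assoc : ∀ {l m n p p' q : GammaOp} (v : SmashMap l m p) (w : SmashMap p n q)
    (v' : SmashMap m n p') (w' : SmashMap l p' q)
    (_ : ∀ c x y, w.toFun (v.toFun c x) y = w'.toFun c (v'.toFun x y))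
    (a : obj l) (b : obj m) (c : obj n), mul (mul a b v) c w = mul a (mul b c v') w'
  mul_comm : ∀ {m n k : GammaOp} (v : SmashMap m n k) (a : obj m) (b : obj n),
    mul a b v = mul b a v.swap

/-- Morphisms of `𝕊`-algebras. -/
@[ext]
structure CommSAlg.Hom (A B : CommSAlg) where
  /-- the underlying morphism of Γ-sets -/
  nat : A.toFunctor ⟶ B.toFunctor
  map_one : A.one ≫ nat = B.one
  map_mul : ∀ {m n k : GammaOp} (v : SmashMap m n k) (a : A.obj m) (b : A.obj n),
    evalAt nat (A.mul a b v) = B.mul (evalAt nat a) (evalAt nat b) v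

instance : Category CommSAlg where
  Hom := CommSAlg.Hom
  id A := ⟨𝟙 _, Category.comp_id _, fun _ _ _ => rfl⟩
  comp f g := ⟨f.nat ≫ g.nat, by rw [← Category.assoc, f.map_one, g.map_one], fun v a b => by
    have h1 := f.map_mul v a b
    have h2 := g.map_mul v (evalAt f.nat a) (evalAt f.nat b)
    rw [← h1] at h2
    exact h2⟩

/-- A module over a commutative `𝕊`-algebra `A`: a Γ-set `M` with an action `A ∧ M → M`. -/
structure SMod (A : CommSAlg) extends GammaSet where
  /-- the action `A ∧ M → M` -/
  act : ∀ {m n k : GammaOp}, A.obj m → obj n → SmashMap m n k → obj k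
  act_map : ∀ {m n m' n' k : GammaOp} (f : m ⟶ m') (g : n ⟶ n') (v : SmashMap m' n' k)
    (a : A.obj m) (x : obj n),
    act (A.mp f a) (toGammaSet.mp g x) v = act a x (v.pre f g)
  map_act : ∀ {m n k k' : GammaOp} (v : SmashMap m n k) (h : k ⟶ k') (a : A.obj m) (x : obj n),
    toGammaSet.mp h (act a x v) = act a x (v.post h)
  one_act : ∀ {m n k : GammaOp} (v : SmashMap m n k) (c : m.Pt) (x : obj n),
    act (evalAt A.one c) x v = toGammaSet.mp (v.slice c) x
  mul_act : ∀ {l m n p p' q : GammaOp} (v : SmashMap l m p) (w : SmashMap p n q)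
    (v' : SmashMap m n p') (w' : SmashMap l p' q)
    (_ : ∀ c x y, w.toFun (v.toFun c x) y = w'.toFun c (v'.toFun x y))
    (a : A.obj l) (b : A.obj m) (x : obj n), act (A.mul a b v) x w = act a (act b x v') w'

namespace SMod

variable {A : CommSAlg}

theorem act_point (M : SMod A) {m n k : GammaOp} (a : A.obj m) (v : SmashMap m n k) :
    M.act a (M.obj n).point v = (M.obj k).point := by
  let z : (⟨0⟩ : GammaOp) ⟶ n := ⟨fun _ => none, rfl⟩
  let t : (⟨0⟩ : GammaOp) ⟶ k := ⟨fun _ => none, rfl⟩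
  let v0 : SmashMap m ⟨0⟩ ⟨0⟩ := ⟨fun _ _ => none, fun _ => rfl, fun _ => rfl⟩
  have h1 : M.act (A.mp (𝟙 m) a) (M.mp z (M.obj ⟨0⟩).point) v = _ := M.act_map (𝟙 m) z v a _
  rw [A.mp_id, M.mp_point] at h1
  have h2 : v.pre (𝟙 m) z = v0.post t := by
    ext1; funext x y; exact v.right_none x
  have h3 : M.act a (M.obj ⟨0⟩).point v0 = (M.obj ⟨0⟩).point := M.subsingleton_zero.elim _ _
  rw [h1, h2, ← M.map_act, h3, M.mp_point]

theorem act_eq_mp (M : SMod A) {m n k : GammaOp} (a : A.obj m) (x : M.obj n) (v : SmashMap m n k) :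
    M.act a x v = M.mp v.lift (M.act a x (SmashMap.univ m n)) := by
  rw [M.map_act, SmashMap.univ_post_lift]

end SMod

/-! ## The smash product over an `𝕊`-algebra -/

/-- Representatives `(m₊, n₊, x, y, v)` of elements of `(M ∧ N)(k₊)`. -/
structure SmashPre {A : CommSAlg} (M N : SMod A) (k : GammaOp) where
  {m : GammaOp}
  {n : GammaOp}
  x : M.obj m
  y : N.obj n
  v : SmashMap m n k

/-- The relations defining `(M ∧_A N)(k₊)`. The first two relations define the colimit
`(M ∧ N)(k₊) = colim M(m₊) ∧ N(n₊)` over all `v : m₊ ∧ n₊ → k₊`;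
the third one is the passage to the coequalizer of the two maps from `M ∧ A ∧ N`, that is,
`(x a) ∧ y ~ x ∧ (a y)`, the right action of the commutative algebra `A` being `x a = a x`. -/
inductive SmashRel {A : CommSAlg} (M N : SMod A) (k : GammaOp) :
    SmashPre M N k → SmashPre M N k → Prop
  | map {m n m' n' : GammaOp} (f : m ⟶ m') (g : n ⟶ n') (x : M.obj m) (y : N.obj n)
      (v : SmashMap m' n' k) :
      SmashRel M N k ⟨x, y, v.pre f g⟩ ⟨M.mp f x, N.mp g y, v⟩
  | point {m n m' n' : GammaOp} (x : M.obj m) (y : N.obj n) (v : SmashMap m n k)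
      (x' : M.obj m') (y' : N.obj n') (v' : SmashMap m' n' k)
      (h : x = (M.obj m).point ∨ y = (N.obj n).point)
      (h' : x' = (M.obj m').point ∨ y' = (N.obj n').point) :
      SmashRel M N k ⟨x, y, v⟩ ⟨x', y', v'⟩
  | balance {l m n p q : GammaOp} (a : A.obj l) (x : M.obj m) (y : N.obj n)
      (r : SmashMap l m p) (w : SmashMap p n k) (s : SmashMap l n q) (w' : SmashMap m q k)
      (h : ∀ c i j, w.toFun (r.toFun c i) j = w'.toFun i (s.toFun c j)) :
      SmashRel M N k ⟨M.act a x r, y, w⟩ ⟨x, N.act a y s, w'⟩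

/-- The set `(M ∧_A N)(k₊)`. -/
def SmashObj {A : CommSAlg} (M N : SMod A) (k : GammaOp) : Type := Quot (SmashRel M N k)

section Smash

variable {A : CommSAlg} (M N : SMod A)

/-- The class of `(m₊, n₊, x, y, v)` in `(M ∧_A N)(k₊)`. -/
def smashMk {M N : SMod A} {m n k : GammaOp} (x : M.obj m) (y : N.obj n) (v : SmashMap m n k) :
    SmashObj M N k := Quot.mk _ ⟨x, y, v⟩

/-- The base point of `(M ∧_A N)(k₊)`. -/
def smashPoint (k : GammaOp) : SmashObj M N k :=
  smashMk (M.obj ⟨0⟩).point (N.obj ⟨0⟩).point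
    (⟨fun _ _ => none, fun _ => rfl, fun _ => rfl⟩ : SmashMap ⟨0⟩ ⟨0⟩ k)

variable {M N}

theorem smashMk_map {m n m' n' k : GammaOp} (f : m ⟶ m') (g : n ⟶ n') (x : M.obj m) (y : N.obj n)
    (v : SmashMap m' n' k) :
    smashMk (M.mp f x) (N.mp g y) v = smashMk x y (v.pre f g) :=
  (Quot.sound (SmashRel.map f g x y v)).symm

theorem smashMk_point {m n k : GammaOp} (x : M.obj m) (y : N.obj n) (v : SmashMap m n k)
    (h : x = (M.obj m).point ∨ y = (N.obj n).point) :
    smashMk x y v = smashPoint M N k :=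
  Quot.sound (SmashRel.point _ _ _ _ _ _ h (Or.inl rfl))

theorem smashMk_act {l m p p' n k : GammaOp} (a : A.obj l) (x : M.obj m) (y : N.obj n)
    (r : SmashMap l m p) (w : SmashMap p n k) (r' : SmashMap l m p') (w' : SmashMap p' n k)
    (h : ∀ c i j, w.toFun (r.toFun c i) j = w'.toFun (r'.toFun c i) j) :
    smashMk (M.act a x r) y w = smashMk (M.act a x r') y w' := by
  rw [M.act_eq_mp a x r, M.act_eq_mp a x r', ← N.mp_id y, smashMk_map, smashMk_map]
  congr 1
  ext1; funext z j
  rcases z with _ | z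
  · exact ((w.pre r.lift (𝟙 n)).left_none j).trans ((w'.pre r'.lift (𝟙 n)).left_none j).symm
  · simp only [SmashMap.pre]
    rw [SmashMap.some_eq_univ z, SmashMap.lift_univ, SmashMap.lift_univ]
    exact h _ _ _

/-- Functoriality of `M ∧_A N` in `k₊`. -/
def smashMap {k k' : GammaOp} (h : k ⟶ k') : SmashObj M N k → SmashObj M N k' :=
  Quot.lift (fun t => smashMk t.x t.y (t.v.post h)) (by
    rintro _ _ (⟨f, g, x, y, v⟩ | ⟨x, y, v, x', y', v', h1, h2⟩ | ⟨a, x, y, r, w, s, w', e⟩)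
    · exact (smashMk_map f g x y (v.post h)).symm
    · exact (smashMk_point _ _ _ h1).trans (smashMk_point _ _ _ h2).symm
    · exact Quot.sound (SmashRel.balance a x y r _ s _ fun c i j =>
        congrArg (PMap.toFun h) (e c i j)))

/-- The action of `A` on `M ∧_A N` through `M`. -/
def smashAct {l k k' : GammaOp} (a : A.obj l) (t : SmashObj M N k) (w : SmashMap l k k') :
    SmashObj M N k' :=
  Quot.lift (fun t => smashMk (M.act a t.x (SmashMap.univ l t.m)) t.y (w.assoc t.v)) (by
    rintro _ _ (⟨f, g, x, y, v⟩ | ⟨x, y, v, x', y', v', h1, h2⟩ | ⟨b, x, y, r, u, s, u', e⟩)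
    · dsimp only
      have h1 := M.act_map (𝟙 l) f (SmashMap.univ l _) a x
      rw [A.mp_id] at h1
      rw [h1, ← M.mp_id (M.act a x ((SmashMap.univ l _).pre (𝟙 l) f)), smashMk_map]
      apply smashMk_act
      intro c i j
      simp only [SmashMap.pre, PMap.id_toFun, SmashMap.assoc_univ]
    · rw [smashMk_point, smashMk_point]
      · exact h2.imp (fun h => by dsimp only; rw [h, M.act_point]) id
      · exact h1.imp (fun h => by dsimp only; rw [h, M.act_point]) id
    · dsimp only
      rename_i lb m n p q
      -- `a (b x) = (b a) x = b (a x)`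
      let uv := SmashMap.univ l p
      let r' : SmashMap lb ⟨l.card * m.card⟩ ⟨l.card * p.card⟩ :=
        ⟨fun d z => z.bind fun i => uv.toFun (some (finProdFinEquiv.symm i).1)
          (r.toFun d (some (finProdFinEquiv.symm i).2)), fun d => by
            cases d <;> simp [r.left_none, uv.right_none], fun d => rfl⟩
      have hr' : ∀ d c i, r'.toFun d ((SmashMap.univ l m).toFun c i) =
          uv.toFun c (r.toFun d i) := by
        intro d c i
        cases c with
        | none => simp [SmashMap.univ, r', uv]
        | some c => cases i with
          | none => simp [SmashMap.univ, r', uv, r.right_none]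
          | some i => simp [SmashMap.univ, r', -finProdFinEquiv_symm_apply]
      let V := SmashMap.univ l lb
      let W : SmashMap ⟨l.card * lb.card⟩ m ⟨l.card * p.card⟩ := uv.assoc r
      have e1 : M.act (A.mul a b V) x W = M.act a (M.act b x r) uv :=
        M.mul_act V W r uv (fun c d i => SmashMap.assoc_univ uv r c d i) a b x
      have e2 : M.act (A.mul b a V.swap) x W = M.act b (M.act a x (SmashMap.univ l m)) r' :=
        M.mul_act V.swap W (SmashMap.univ l m) r'
          (fun d c i => (SmashMap.assoc_univ uv r c d i).trans (hr' d c i).symm) b a x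
      rw [← e1, A.mul_comm, e2]
      apply Quot.sound
      apply SmashRel.balance
      intro d z j
      rcases z with _ | z
      · rw [r'.right_none, SmashMap.left_none, SmashMap.left_none]
      · rw [SmashMap.some_eq_univ z, hr', SmashMap.assoc_univ, SmashMap.assoc_univ, e]) t

theorem smashAct_mk {l m n p k k' : GammaOp} (a : A.obj l) (x : M.obj m) (y : N.obj n)
    (v : SmashMap m n k) (w : SmashMap l k k') (r : SmashMap l m p) (u : SmashMap p n k')
    (h : ∀ c i j, u.toFun (r.toFun c i) j = w.toFun c (v.toFun i j)) :
    smashAct a (smashMk x y v) w = smashMk (M.act a x r) y u :=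
  smashMk_act _ _ _ _ _ _ _ fun c i j => (SmashMap.assoc_univ w v c i j).trans (h c i j).symm

variable (M N)

/-- The Γ-set `M ∧_A N`. -/
def smashGamma : GammaSet where
  obj k := Pointed.of (smashPoint M N k)
  map h := ⟨smashMap h, smashMk_point _ _ _ (Or.inl rfl)⟩
  map_id k := by
    apply Pointed.Hom.ext; funext t
    obtain ⟨x, y, v⟩ := t
    rfl
  map_comp f g := by
    apply Pointed.Hom.ext; funext t
    obtain ⟨x, y, v⟩ := t
    rfl
  subsingleton_zero := ⟨by
    suffices H : ∀ t : SmashObj M N ⟨0⟩, t = smashPoint M N ⟨0⟩ from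
      fun s t => (H s).trans (H t).symm
    rintro ⟨x, y, v⟩
    rename_i m n
    let z : ∀ m : GammaOp, m ⟶ ⟨0⟩ := fun m => ⟨fun _ => none, rfl⟩
    let v0 : SmashMap ⟨0⟩ ⟨0⟩ ⟨0⟩ := ⟨fun _ _ => none, fun _ => rfl, fun _ => rfl⟩
    have hv : v = v0.pre (z m) (z n) := by
      ext1; funext i j
      rcases h : v.toFun i j with _ | c
      · rfl
      · exact c.elim0
    change smashMk x y v = _
    rw [hv, ← smashMk_map]
    exact smashMk_point _ _ _ (Or.inl (M.subsingleton_zero.elim _ _))⟩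

/-- The smash product `M ∧_A N`, as an `A`-module. -/
def smash : SMod A where
  toGammaSet := smashGamma M N
  act a t v := smashAct a t v
  act_map f g v a t := by
    obtain ⟨x, y, u⟩ := t
    change smashAct (A.mp f a) (smashMk x y (u.post g)) v = smashAct a (smashMk x y u) (v.pre f g)
    have h := M.act_map f (𝟙 _) (SmashMap.univ _ _) a x
    rw [M.mp_id] at h
    rw [smashAct_mk _ _ _ _ _ _ _ (SmashMap.assoc_univ _ _), h]
    symm
    apply smashAct_mk
    intro c i j
    simp only [SmashMap.pre, PMap.id_toFun, SmashMap.assoc_univ]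
    rfl
  map_act v h a t := by
    obtain ⟨x, y, u⟩ := t
    change smashMk _ _ _ = smashAct a (smashMk x y u) _
    symm
    apply smashAct_mk
    intro c i j
    exact congrArg (PMap.toFun h) (SmashMap.assoc_univ v u c i j)
  one_act v c t := by
    obtain ⟨x, y, u⟩ := t
    rename_i m n
    change smashAct _ (smashMk x y u) v = smashMk x y (u.post (v.slice c))
    rw [smashAct_mk _ _ _ _ _ _ _ (SmashMap.assoc_univ _ _), M.one_act]
    rw [← N.mp_id y, smashMk_map, N.mp_id]
    congr 1
    ext1; funext i j
    exact SmashMap.assoc_univ v u c i j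
  mul_act v w v' w' h a b t := by
    obtain ⟨x, y, u⟩ := t
    change smashAct _ (smashMk x y u) w = smashAct a (smashAct b (smashMk x y u) v') w'
    rw [smashAct_mk b x y u v' _ _ (SmashMap.assoc_univ _ _),
      smashAct_mk a _ y _ w' _ _ (SmashMap.assoc_univ _ _),
      smashAct_mk _ x y u w _ _ (SmashMap.assoc_univ _ _)]
    rename_i m' n'
    have e1 : A.mul a b v = A.mp v.lift (A.mul a b (SmashMap.univ _ _)) := by
      rw [A.map_mul, SmashMap.univ_post_lift]
    have e2 := M.act_map v.lift (𝟙 m') (SmashMap.univ _ m') (A.mul a b (SmashMap.univ _ _)) x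
    rw [M.mp_id] at e2
    rw [e1, e2, ← M.mul_act (SmashMap.univ _ _)
      (SmashMap.assoc (SmashMap.univ _ _) (SmashMap.univ _ _))
      (SmashMap.univ _ m') (SmashMap.univ _ _) (SmashMap.assoc_univ _ _)]
    apply smashMk_act
    intro z i j
    rcases z with _ | z
    · rw [SmashMap.left_none, SmashMap.left_none, SmashMap.left_none, SmashMap.left_none]
    · rename_i l0 m0 p0 q0 p1 q1
      rw [SmashMap.some_eq_univ z, SmashMap.assoc_univ, SmashMap.assoc_univ, SmashMap.assoc_univ]
      simp only [SmashMap.pre, PMap.id_toFun, SmashMap.lift_univ, SmashMap.assoc_univ]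
      exact h _ _ _

end Smash

/-! ## Sheaves of modules over a presheaf of `𝕊`-algebras -/

section Sheaves

variable {X : TopCat.{0}} (O : TopCat.Presheaf CommSAlg X)

/-- Restriction of sections of `O`. -/
abbrev resAlg {U V : Opens X} (h : U ≤ V) {n : GammaOp} (a : (O.obj (op V)).obj n) :
    (O.obj (op U)).obj n := evalAt (CommSAlg.Hom.nat (O.map (homOfLE h).op)) a

theorem resAlg_res {U V W : Opens X} (h : U ≤ V) (h' : V ≤ W) {n : GammaOp}
    (a : (O.obj (op W)).obj n) : resAlg O h (resAlg O h' a) = resAlg O (h.trans h') a := by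
  have e : O.map (homOfLE (h.trans h')).op = O.map (homOfLE h').op ≫ O.map (homOfLE h).op := by
    rw [← O.map_comp]; rfl
  unfold resAlg
  rw [e]
  rfl

theorem resAlg_mul {U V : Opens X} (h : U ≤ V) {m n k : GammaOp} (a : (O.obj (op V)).obj m)
    (b : (O.obj (op V)).obj n) (v : SmashMap m n k) :
    resAlg O h ((O.obj (op V)).mul a b v) = (O.obj (op U)).mul (resAlg O h a) (resAlg O h b) v :=
  CommSAlg.Hom.map_mul _ v a b

theorem resAlg_one {U V : Opens X} (h : U ≤ V) {n : GammaOp} (c : n.Pt) :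
    resAlg O h (evalAt (O.obj (op V)).one c) = evalAt (O.obj (op U)).one c := by
  rw [← CommSAlg.Hom.map_one (O.map (homOfLE h).op)]
  rfl

/-- A presheaf of `O`-modules. -/
structure PresheafOfSMod where
  /-- the sections over `U` -/
  obj : ∀ U : Opens X, SMod (O.obj (op U))
  /-- the restriction maps -/
  res : ∀ {U V : Opens X}, U ≤ V → ((obj V).toFunctor ⟶ (obj U).toFunctor)
  res_self : ∀ (U : Opens X), res (le_refl U) = 𝟙 _
  res_res : ∀ {U V W : Opens X} (h : U ≤ V) (h' : V ≤ W), res h' ≫ res h = res (h.trans h')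
  res_act : ∀ {U V : Opens X} (h : U ≤ V) {m n k : GammaOp} (v : SmashMap m n k)
    (a : (O.obj (op V)).obj m) (x : (obj V).obj n),
    evalAt (res h) ((obj V).act a x v) = (obj U).act (resAlg O h a) (evalAt (res h) x) v

variable {O}

/-- Morphisms of presheaves of `O`-modules. -/
@[ext]
structure PresheafOfSMod.Hom (M N : PresheafOfSMod O) where
  /-- the map on sections over `U` -/
  app : ∀ U : Opens X, (M.obj U).toFunctor ⟶ (N.obj U).toFunctor
  app_res : ∀ {U V : Opens X} (h : U ≤ V), app V ≫ N.res h = M.res h ≫ app U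
  app_act : ∀ (U : Opens X) {m n k : GammaOp} (v : SmashMap m n k)
    (a : (O.obj (op U)).obj m) (x : (M.obj U).obj n),
    evalAt (app U) ((M.obj U).act a x v) = (N.obj U).act a (evalAt (app U) x) v

instance : Category (PresheafOfSMod O) where
  Hom := PresheafOfSMod.Hom
  id M := ⟨fun U => 𝟙 _, fun h => by rw [Category.id_comp, Category.comp_id],
    fun _ _ _ _ _ _ _ => rfl⟩
  comp f g := ⟨fun U => f.app U ≫ g.app U, fun h => by
      rw [Category.assoc, g.app_res, ← Category.assoc, f.app_res, Category.assoc],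
    fun U _ _ _ v a x => by
      have h1 := f.app_act U v a x
      have h2 := g.app_act U v a (evalAt (f.app U) x)
      rw [← h1] at h2
      exact h2⟩

/-- The sheaf condition: for all `k`, compatible families of sections in `M(U i)(k₊)`
glue uniquely. -/
def PresheafOfSMod.IsSheaf (M : PresheafOfSMod O) : Prop :=
  ∀ (ι : Type) (U : ι → Opens X) (n : GammaOp) (s : ∀ i, (M.obj (U i)).obj n),
    (∀ i j, evalAt (M.res (inf_le_left : U i ⊓ U j ≤ U i)) (s i) =
      evalAt (M.res (inf_le_right : U i ⊓ U j ≤ U j)) (s j)) →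
    ∃! t : (M.obj (⨆ i, U i)).obj n, ∀ i, evalAt (M.res (le_iSup U i)) t = s i

variable (O) in
/-- The category of sheaves of `O`-modules, a full subcategory of the presheaves. -/
abbrev SheafOfSMod : Type 1 :=
  ObjectProperty.FullSubcategory (PresheafOfSMod.IsSheaf (O := O))

namespace PresheafOfSMod

variable (M N : PresheafOfSMod O)

theorem res_res_apply {U V W : Opens X} (h : U ≤ V) (h' : V ≤ W) {n : GammaOp}
    (x : (M.obj W).obj n) :
    evalAt (M.res h) (evalAt (M.res h') x) = evalAt (M.res (h.trans h')) x := by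
  rw [← M.res_res h h']; rfl

theorem res_self_apply {U : Opens X} (h : U ≤ U) {n : GammaOp} (x : (M.obj U).obj n) :
    evalAt (M.res h) x = x := by
  rw [M.res_self U]; rfl

/-! ### The smash product presheaf -/

/-- Restriction maps `M(V) ∧_{O(V)} N(V) → M(U) ∧_{O(U)} N(U)`. -/
def smashRes {U V : Opens X} (h : U ≤ V) (k : GammaOp) :
    SmashObj (M.obj V) (N.obj V) k → SmashObj (M.obj U) (N.obj U) k :=
  Quot.lift (fun t => smashMk (evalAt (M.res h) t.x) (evalAt (N.res h) t.y) t.v) (by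
    rintro _ _ (⟨f, g, x, y, v⟩ | ⟨x, y, v, x', y', v', h1, h2⟩ | ⟨a, x, y, r, w, s, w', e⟩)
    · dsimp only
      rw [evalAt_map, evalAt_map]
      exact (smashMk_map f g _ _ v).symm
    · dsimp only
      rw [smashMk_point, smashMk_point]
      · exact h2.imp (fun h => by rw [h]; exact Pointed.Hom.map_point _)
          (fun h => by rw [h]; exact Pointed.Hom.map_point _)
      · exact h1.imp (fun h => by rw [h]; exact Pointed.Hom.map_point _)
          (fun h => by rw [h]; exact Pointed.Hom.map_point _)
    · dsimp only
      rw [M.res_act, N.res_act]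
      exact Quot.sound (SmashRel.balance _ _ _ r w s w' e))

/-- The presheaf `U ↦ M(U) ∧_{O(U)} N(U)`. -/
def smash : PresheafOfSMod O where
  obj U := GammaArith.smash (M.obj U) (N.obj U)
  res {U V} h :=
    { app := fun k => ⟨smashRes M N h k, smashMk_point _ _ _ (Or.inl (Pointed.Hom.map_point _))⟩
      naturality := by
        intro k k' f
        apply Pointed.Hom.ext; funext t
        obtain ⟨x, y, v⟩ := t
        rfl }
  res_self U := by
    apply NatTrans.ext; funext k; apply Pointed.Hom.ext; funext t
    obtain ⟨x, y, v⟩ := t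
    change smashMk (evalAt (M.res _) x) (evalAt (N.res _) y) v = smashMk x y v
    rw [res_self_apply, res_self_apply]
  res_res h h' := by
    apply NatTrans.ext; funext k; apply Pointed.Hom.ext; funext t
    obtain ⟨x, y, v⟩ := t
    change smashMk (evalAt (M.res _) (evalAt (M.res _) x))
      (evalAt (N.res _) (evalAt (N.res _) y)) v = smashMk (evalAt (M.res _) x) (evalAt (N.res _) y) v
    rw [res_res_apply, res_res_apply]
  res_act {U V} h {m n k} v a t := by
    obtain ⟨x, y, u⟩ := t
    change smashMk (evalAt (M.res h) ((M.obj V).act a x _)) (evalAt (N.res h) y) _ =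
      smashMk ((M.obj U).act _ (evalAt (M.res h) x) _) (evalAt (N.res h) y) _
    rw [M.res_act]

/-! ### The associated sheaf -/

/-- Sections of `M` at level `k₊` on neighbourhoods of the point `p`. -/
structure PreGerm (p : X) (k : GammaOp) where
  /-- the neighbourhood -/
  U : Opens X
  mem : p ∈ U
  /-- the section -/
  s : (M.obj U).obj k

/-- Two sections have the same germ at `p` if they agree on a neighbourhood of `p`. -/
instance germSetoid (p : X) (k : GammaOp) : Setoid (M.PreGerm p k) where
  r s t := ∃ (W : Opens X) (hs : W ≤ s.U) (ht : W ≤ t.U), p ∈ W ∧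
    evalAt (M.res hs) s.s = evalAt (M.res ht) t.s
  iseqv :=
    { refl := fun s => ⟨s.U, le_refl _, le_refl _, s.mem, rfl⟩
      symm := fun ⟨W, hs, ht, hp, e⟩ => ⟨W, ht, hs, hp, e.symm⟩
      trans := by
        rintro s t u ⟨W, hs, ht, hp, e⟩ ⟨W', ht', hu, hp', e'⟩
        refine ⟨W ⊓ W', inf_le_left.trans hs, inf_le_right.trans hu, ⟨hp, hp'⟩, ?_⟩
        rw [← M.res_res_apply inf_le_left hs, e, M.res_res_apply, ← M.res_res_apply inf_le_right hu,
          ← e', M.res_res_apply] }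

/-- The stalk of `M` at `p` at level `k₊`. -/
def Stalk (p : X) (k : GammaOp) : Type := Quotient (M.germSetoid p k)

variable {M} in
/-- The germ at `p` of a section over `U`. -/
def germ {U : Opens X} {p : X} (hp : p ∈ U) {k : GammaOp} (s : (M.obj U).obj k) : M.Stalk p k :=
  Quotient.mk _ ⟨U, hp, s⟩

theorem germ_res {U V : Opens X} (h : U ≤ V) {p : X} (hp : p ∈ U) {k : GammaOp}
    (s : (M.obj V).obj k) : germ hp (evalAt (M.res h) s) = germ (h hp) s :=
  Quotient.sound ⟨U, le_refl _, h, hp, M.res_self_apply _ _⟩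

/-- Functoriality of the stalk in `k₊`. -/
def stalkMap (p : X) {k k' : GammaOp} (f : k ⟶ k') : M.Stalk p k → M.Stalk p k' :=
  Quotient.lift (fun s => germ s.mem ((M.obj s.U).mp f s.s)) (by
    rintro s t ⟨W, hs, ht, hpW, e⟩
    rw [← M.germ_res hs hpW, ← M.germ_res ht hpW, evalAt_map, evalAt_map, e])

/-- The action of a section of `O` near `p` on the stalk at `p`. -/
def stalkAct {p : X} {U : Opens X} (hp : p ∈ U) {m n k : GammaOp} (a : (O.obj (op U)).obj m)
    (t : M.Stalk p n) (v : SmashMap m n k) : M.Stalk p k :=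
  Quotient.lift (fun s : M.PreGerm p n => (germ (⟨hp, s.mem⟩ : p ∈ U ⊓ s.U)
    ((M.obj (U ⊓ s.U)).act (resAlg O inf_le_left a) (evalAt (M.res inf_le_right) s.s) v) :
      M.Stalk p k)) (by
    rintro s t ⟨W, hs, ht, hpW, e⟩
    rw [← M.germ_res (inf_le_inf_left U hs) (⟨hp, hpW⟩ : p ∈ U ⊓ W),
      ← M.germ_res (inf_le_inf_left U ht) (⟨hp, hpW⟩ : p ∈ U ⊓ W), M.res_act, M.res_act, resAlg_res, resAlg_res,
      M.res_res_apply, M.res_res_apply, ← M.res_res_apply inf_le_right hs,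
      ← M.res_res_apply inf_le_right ht, e]) t

theorem stalkAct_germ {p : X} {U V W : Opens X} (hp : p ∈ U) (hV : p ∈ V) (hW : p ∈ W)
    (hU' : W ≤ U) (hV' : W ≤ V) {m n k : GammaOp} (a : (O.obj (op U)).obj m)
    (s : (M.obj V).obj n) (v : SmashMap m n k) :
    M.stalkAct hp a (germ hV s) v =
      germ hW ((M.obj W).act (resAlg O hU' a) (evalAt (M.res hV') s) v) := by
  change germ _ _ = _
  rw [← M.germ_res (le_inf hU' hV') hW, M.res_act, resAlg_res, M.res_res_apply]

/-- Sections over `U` of the associated sheaf at level `k₊`: families of germs that are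
locally the germs of one section of `M`. -/
structure ShSections (U : Opens X) (k : GammaOp) where
  /-- the germs of the section -/
  val : ∀ p : X, p ∈ U → M.Stalk p k
  local_germ : ∀ (p : X) (_ : p ∈ U), ∃ (V : Opens X) (h : V ≤ U) (_ : p ∈ V)
    (t : (M.obj V).obj k), ∀ (q : X) (hq : q ∈ V), val q (h hq) = germ hq t

variable {M} in
theorem ShSections.ext' {U : Opens X} {k : GammaOp} {s t : M.ShSections U k}
    (h : ∀ p hp, s.val p hp = t.val p hp) : s = t := by
  cases s; cases t
  congr
  funext p hp
  exact h p hp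

variable {M} in
/-- The section of the associated sheaf defined by a section of `M`. -/
def toSh {U : Opens X} {k : GammaOp} (t : (M.obj U).obj k) : M.ShSections U k :=
  ⟨fun _ hp => germ hp t, fun _ hp => ⟨U, le_refl _, hp, t, fun _ _ => rfl⟩⟩

/-- The sections over `U` of the associated sheaf, as a Γ-set. -/
def shGamma (U : Opens X) : GammaSet where
  obj k := Pointed.of (toSh ((M.obj U).obj k).point : M.ShSections U k)
  map {k k'} f := ⟨fun s => ⟨fun p hp => M.stalkMap p f (ShSections.val s p hp), fun p hp => by
      obtain ⟨V, h, hpV, t, ht⟩ := ShSections.local_germ s p hp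
      exact ⟨V, h, hpV, (M.obj V).mp f t, fun q hq =>
        congrArg (M.stalkMap q f) (ht q hq)⟩⟩, by
      apply ShSections.ext'; intro p hp
      change germ hp ((M.obj U).mp f _) = _
      rw [GammaSet.mp_point]
      rfl⟩
  map_id k := by
    apply Pointed.Hom.ext; funext s; apply ShSections.ext'; intro p hp
    change M.stalkMap p (𝟙 k) (ShSections.val s p hp) = ShSections.val s p hp
    obtain ⟨t, ht⟩ := Quotient.exists_rep (ShSections.val s p hp)
    rw [← ht]
    change germ t.mem ((M.obj t.U).mp _ t.s) = germ t.mem t.s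
    rw [GammaSet.mp_id]
  map_comp f g := by
    apply Pointed.Hom.ext; funext s; apply ShSections.ext'; intro p hp
    change M.stalkMap p (f ≫ g) (ShSections.val s p hp) = M.stalkMap p g (M.stalkMap p f (ShSections.val s p hp))
    obtain ⟨t, ht⟩ := Quotient.exists_rep (ShSections.val s p hp)
    rw [← ht]
    change germ t.mem ((M.obj t.U).mp _ t.s) = germ t.mem ((M.obj t.U).mp g ((M.obj t.U).mp f t.s))
    rw [GammaSet.mp_comp]
  subsingleton_zero := ⟨by
    intro s t
    apply ShSections.ext'; intro p hp
    obtain ⟨a, ha⟩ := Quotient.exists_rep (ShSections.val s p hp)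
    obtain ⟨b, hb⟩ := Quotient.exists_rep (ShSections.val t p hp)
    rw [← ha, ← hb]
    exact Quotient.sound ⟨a.U ⊓ b.U, inf_le_left, inf_le_right, ⟨a.mem, b.mem⟩,
      (M.obj _).subsingleton_zero.elim _ _⟩⟩

/-- The sections over `U` of the associated sheaf, as an `O(U)`-module. -/
def shMod (U : Opens X) : SMod (O.obj (op U)) where
  toGammaSet := M.shGamma U
  act {m n k} a s v := ⟨fun p hp => M.stalkAct hp a (ShSections.val s p hp) v, fun p hp => by
    obtain ⟨V, h, hpV, t, ht⟩ := ShSections.local_germ s p hp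
    refine ⟨V, h, hpV, (M.obj V).act (resAlg O h a) t v, fun q hq => ?_⟩
    refine (congrArg (fun z => M.stalkAct (h hq) a z v) (ht q hq)).trans ?_
    rw [M.stalkAct_germ (h hq) hq hq h le_rfl, M.res_self_apply]⟩
  act_map f g v a s := by
    apply ShSections.ext'; intro p hp
    change M.stalkAct hp _ (M.stalkMap p g (ShSections.val s p hp)) v = M.stalkAct hp a (ShSections.val s p hp) _
    obtain ⟨t, ht⟩ := Quotient.exists_rep (ShSections.val s p hp)
    rw [← ht]
    change M.stalkAct hp _ (germ t.mem ((M.obj t.U).mp g t.s)) v = germ _ _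
    rw [M.stalkAct_germ hp t.mem (⟨hp, t.mem⟩ : p ∈ U ⊓ t.U) inf_le_left inf_le_right, evalAt_map]
    rw [← (M.obj _).act_map f g v]
    congr 2
    exact evalAt_map _ _ _
  map_act v h a s := by
    apply ShSections.ext'; intro p hp
    change M.stalkMap p h (M.stalkAct hp a (ShSections.val s p hp) v) = M.stalkAct hp a (ShSections.val s p hp) _
    obtain ⟨t, ht⟩ := Quotient.exists_rep (ShSections.val s p hp)
    rw [← ht]
    change germ _ ((M.obj _).mp h _) = germ _ _
    rw [(M.obj _).map_act]
  one_act v c s := by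
    apply ShSections.ext'; intro p hp
    change M.stalkAct hp _ (ShSections.val s p hp) v = M.stalkMap p _ (ShSections.val s p hp)
    obtain ⟨t, ht⟩ := Quotient.exists_rep (ShSections.val s p hp)
    rw [← ht]
    change germ _ _ = germ t.mem ((M.obj t.U).mp _ t.s)
    rw [resAlg_one, (M.obj _).one_act, ← M.germ_res inf_le_right (⟨hp, t.mem⟩ : p ∈ _ ⊓ t.U), evalAt_map]
  mul_act v w v' w' h a b s := by
    apply ShSections.ext'; intro p hp
    change M.stalkAct hp _ (ShSections.val s p hp) w =
      M.stalkAct hp a (M.stalkAct hp b (ShSections.val s p hp) v') w'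
    obtain ⟨t, ht⟩ := Quotient.exists_rep (ShSections.val s p hp)
    rw [← ht]
    have e := M.stalkAct_germ hp t.mem (⟨hp, t.mem⟩ : p ∈ U ⊓ t.U) inf_le_left inf_le_right b t.s v'
    change M.stalkAct hp _ (germ t.mem t.s) w = M.stalkAct hp a (M.stalkAct hp b (germ t.mem t.s) v') w'
    rw [e, M.stalkAct_germ hp t.mem (⟨hp, t.mem⟩ : p ∈ U ⊓ t.U) inf_le_left inf_le_right,
      M.stalkAct_germ hp (⟨hp, t.mem⟩ : p ∈ U ⊓ t.U) (⟨hp, t.mem⟩ : p ∈ U ⊓ t.U) inf_le_left le_rfl, M.res_self_apply,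
      resAlg_mul, (M.obj _).mul_act v w v' w' h]

/-- The presheaf of `O`-modules underlying the associated sheaf. -/
def shPresheaf : PresheafOfSMod O where
  obj U := M.shMod U
  res {U V} h :=
    { app := fun k => ⟨fun s => ⟨fun p hp => ShSections.val s p (h hp), fun p hp => by
        obtain ⟨W, hW, hpW, t, ht⟩ := ShSections.local_germ s p (h hp)
        refine ⟨U ⊓ W, inf_le_left, ⟨hp, hpW⟩, evalAt (M.res inf_le_right) t, fun q hq => ?_⟩
        rw [M.germ_res]
        exact ht q hq.2⟩, by
        apply ShSections.ext'; intro p hp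
        change germ (h hp) _ = germ hp _
        rw [← M.germ_res h hp]
        congr 1
        exact Pointed.Hom.map_point _⟩
      naturality := fun _ _ _ => rfl }
  res_self U := rfl
  res_res h h' := rfl
  res_act {U V} h m n k v a s := by
    apply ShSections.ext'; intro p hp
    change M.stalkAct (h hp) a (ShSections.val s p (h hp)) v = M.stalkAct hp (resAlg O h a) (ShSections.val s p (h hp)) v
    obtain ⟨t, ht⟩ := Quotient.exists_rep (ShSections.val s p (h hp))
    rw [← ht]
    change M.stalkAct (h hp) a (germ t.mem t.s) v = M.stalkAct hp (resAlg O h a) (germ t.mem t.s) v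
    rw [M.stalkAct_germ hp t.mem (⟨hp, t.mem⟩ : p ∈ U ⊓ t.U) inf_le_left inf_le_right,
      M.stalkAct_germ (h hp) t.mem (⟨hp, t.mem⟩ : p ∈ U ⊓ t.U) (inf_le_left.trans h) inf_le_right, resAlg_res]

theorem shPresheaf_isSheaf : M.shPresheaf.IsSheaf := by
  intro ι U n s hs
  have key : ∀ (p : X) (i j : ι) (hi : p ∈ U i) (hj : p ∈ U j), ShSections.val (s i) p hi = ShSections.val (s j) p hj := by
    intro p i j hi hj
    exact congrFun (congrFun (congrArg ShSections.val (hs i j)) p) ⟨hi, hj⟩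
  have ex : ∀ p : X, p ∈ ⨆ i, U i → ∃ i, p ∈ U i := fun p hp => Opens.mem_iSup.1 hp
  refine ⟨⟨fun p hp => ShSections.val (s (ex p hp).choose) p (ex p hp).choose_spec, fun p hp => ?_⟩, ?_, ?_⟩
  · obtain ⟨i, hi⟩ := ex p hp
    obtain ⟨V, h, hpV, t, ht⟩ := ShSections.local_germ (s i) p hi
    exact ⟨V, h.trans (le_iSup U i), hpV, t, fun q hq => (key q _ i _ (h hq)).trans (ht q hq)⟩
  · intro i
    apply ShSections.ext'; intro p hp
    exact key p _ i _ hp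
  · intro t ht
    apply ShSections.ext'; intro p hp
    have e := ht (ex p hp).choose
    exact congrFun (congrFun (congrArg ShSections.val e) p) (ex p hp).choose_spec

/-- The sheaf associated to a presheaf of `O`-modules. -/
def sheafify : SheafOfSMod O := ⟨M.shPresheaf, M.shPresheaf_isSheaf⟩

end PresheafOfSMod

/-- The smash product `M ∧_O N` of sheaves of `O`-modules: the sheaf associated to the presheaf
`U ↦ M(U) ∧_{O(U)} N(U)`. -/
def SheafOfSMod.smash (M N : SheafOfSMod O) : SheafOfSMod O := (M.obj.smash N.obj).sheafify

/-- The section of `M ∧_O N` over `U` at level `k₊` defined by sections `x` of `M` and `y` of `N`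
over `U` at levels `m₊`, `n₊` and a map `v : m₊ ∧ n₊ → k₊`. -/
def SheafOfSMod.smashSec {M N : SheafOfSMod O} {U : Opens X} {m n k : GammaOp}
    (x : (M.obj.obj U).obj m) (y : (N.obj.obj U).obj n) (v : SmashMap m n k) :
    ((SheafOfSMod.smash M N).obj.obj U).obj k :=
  PresheafOfSMod.toSh (M := M.obj.smash N.obj) (smashMk x y v)

end Sheaves

/-! ## The space `Spec ℤ ∪ {∞}` -/

/-- The points of `Spec ℤ ∪ {∞}`: the generic point `(0)`, the primes, and `∞`. -/
inductive SpecZPt : Type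
  | generic
  | prime (p : Nat.Primes)
  | infty

/-- The nonempty open sets are the complements of the finite sets of points that do not
contain the generic point. -/
instance : TopologicalSpace SpecZPt where
  IsOpen U := U = ∅ ∨ (SpecZPt.generic ∈ U ∧ Uᶜ.Finite)
  isOpen_univ := Or.inr ⟨trivial, by simp⟩
  isOpen_inter := by
    rintro U V (rfl | ⟨hU, hU'⟩) (rfl | ⟨hV, hV'⟩)
    · simp
    · simp
    · simp
    · exact Or.inr ⟨⟨hU, hV⟩, by rw [Set.compl_inter]; exact hU'.union hV'⟩
  isOpen_sUnion := by
    intro S hS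
    by_cases h : ∃ U ∈ S, U ≠ ∅
    · obtain ⟨U, hU, hne⟩ := h
      obtain ⟨h1, h2⟩ := (hS U hU).resolve_left hne
      exact Or.inr ⟨⟨U, hU, h1⟩,
        h2.subset (Set.compl_subset_compl.2 (Set.subset_sUnion_of_mem hU))⟩
    · push Not at h
      left
      rw [Set.sUnion_eq_empty]
      exact h

/-- The Arakelov compactification of `Spec ℤ`, as a topological space. -/
abbrev SpecZBar : TopCat.{0} := TopCat.of SpecZPt

theorem generic_mem {U : Opens SpecZBar} (h : U ≠ ⊥) : SpecZPt.generic ∈ U := by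
  rcases U.2 with h' | h'
  · exact absurd (Opens.ext h') h
  · exact h'.1

/-- Divisors on `Spec ℤ`. -/
abbrev FinDivisor : Type := Nat.Primes →₀ ℤ

/-- Arakelov divisors `D = (D_finite, a)`, where `D_∞ = a {∞}`. -/
abbrev ArakelovDivisor : Type := FinDivisor × ℝ

/-- The finite part `∑ ord_p(q) p` of the principal divisor of `q`. -/
noncomputable def principalFin (q : ℚˣ) : FinDivisor :=
  Finsupp.ofSupportFinite (fun p => padicValRat p (q : ℚ)) (by
    have hf : ∀ n : ℕ, n ≠ 0 → {p : Nat.Primes | (p : ℕ) ∣ n}.Finite := fun n hn =>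
      Set.Finite.of_finite_image (f := fun p : Nat.Primes => (p : ℕ))
        ((n.divisors.finite_toSet).subset (by
          rintro _ ⟨p, hp, rfl⟩
          exact Nat.mem_divisors.2 ⟨hp, hn⟩))
        (fun a _ b _ h => Subtype.ext h)
    refine ((hf (q : ℚ).num.natAbs (by simp)).union (hf (q : ℚ).den (q : ℚ).den_nz)).subset ?_
    intro p hp
    by_contra hc
    rw [Set.mem_union, not_or] at hc
    apply hp
    have h1 : padicValNat p (q : ℚ).num.natAbs = 0 := padicValNat.eq_zero_of_not_dvd hc.1
    have h2 : padicValNat p (q : ℚ).den = 0 := padicValNat.eq_zero_of_not_dvd hc.2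
    simp [padicValRat, padicValInt, h1, h2])

/-- The principal divisor `(q) = (q)_finite - log |q| {∞}`. -/
noncomputable def principal (q : ℚˣ) : ArakelovDivisor :=
  (principalFin q, -Real.log |((q : ℚ) : ℝ)|)

/-- The sections over `U ∩ Spec ℤ` of the sheaf `O(D)` of a divisor `D` on `Spec ℤ`, viewed as a
subgroup of `ℚ`; the value on the empty set is zero. -/
def finSections (D : FinDivisor) (U : Opens SpecZBar) : AddSubgroup ℚ where
  carrier := {q | (∀ p : Nat.Primes, SpecZPt.prime p ∈ U → q = 0 ∨ 0 ≤ padicValRat p q + D p) ∧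
    (U = ⊥ → q = 0)}
  zero_mem' := ⟨fun _ _ => Or.inl rfl, fun _ => rfl⟩
  neg_mem' := fun {q} h => ⟨fun p hp => by
    rw [padicValRat.neg, neg_eq_zero]; exact h.1 p hp, fun hU => by rw [h.2 hU, neg_zero]⟩
  add_mem' := fun {q r} hq hr => ⟨fun p hp => by
    have : Fact (p : ℕ).Prime := ⟨p.2⟩
    by_cases h : q + r = 0
    · exact Or.inl h
    rcases hq.1 p hp with rfl | hq1
    · rw [zero_add]; exact hr.1 p hp
    rcases hr.1 p hp with rfl | hr1
    · rw [add_zero]; exact Or.inr hq1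
    refine Or.inr ?_
    have := padicValRat.min_le_padicValRat_add (p := p) h
    rcases min_le_iff.1 this with h' | h' <;> omega, fun hU => by rw [hq.2 hU, hr.2 hU, add_zero]⟩

theorem finSections_mul {D D' : FinDivisor} {U : Opens SpecZBar} {q r : ℚ}
    (hq : q ∈ finSections D U) (hr : r ∈ finSections D' U) : q * r ∈ finSections (D + D') U :=
  ⟨fun p hp => by
    have : Fact (p : ℕ).Prime := ⟨p.2⟩
    by_cases h0 : q = 0
    · exact Or.inl (by rw [h0, zero_mul])
    by_cases h1 : r = 0
    · exact Or.inl (by rw [h1, mul_zero])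
    have h2 := (hq.1 p hp).resolve_left h0
    have h3 := (hr.1 p hp).resolve_left h1
    refine Or.inr ?_
    rw [padicValRat.mul h0 h1, Finsupp.add_apply]
    omega, fun hU => by rw [hq.2 hU, zero_mul]⟩

/-- The image in `ℚ` of the unit section over `U`: it is `1`, except that it is `0` on the empty
set, where all sections vanish. Multiplication by it is the restriction to `U`. -/
noncomputable def unitSec (U : Opens SpecZBar) : ℚ :=
  letI := Classical.propDecidable (U = ⊥)
  if U = ⊥ then 0 else 1

theorem unitSec_bot : unitSec ⊥ = 0 := by simp [unitSec]

theorem unitSec_of_ne {U : Opens SpecZBar} (h : U ≠ ⊥) : unitSec U = 1 := by simp [unitSec, h]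

theorem unitSec_mul {D : FinDivisor} {U : Opens SpecZBar} {q : ℚ} (hq : q ∈ finSections D U) :
    unitSec U * q = q := by
  by_cases h : U = ⊥
  · rw [hq.2 h, mul_zero]
  · rw [unitSec_of_ne h, one_mul]

theorem unitSec_mul_unitSec {U V : Opens SpecZBar} (h : U ≤ V) :
    unitSec U * unitSec V = unitSec U := by
  by_cases hU : U = ⊥
  · rw [hU, unitSec_bot, zero_mul]
  · rw [unitSec_of_ne (U := V) (fun hV => hU (le_bot_iff.1 (hV ▸ h))), mul_one]

theorem unitSec_mem (U : Opens SpecZBar) : unitSec U ∈ finSections 0 U :=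
  ⟨fun p _ => by
    by_cases h : U = ⊥
    · exact Or.inl (by rw [h, unitSec_bot])
    · exact Or.inr (by rw [unitSec_of_ne h]; simp), fun h => by rw [h, unitSec_bot]⟩

theorem abs_unitSec_le (U : Opens SpecZBar) : |unitSec U| ≤ 1 := by
  by_cases h : U = ⊥
  · rw [h, unitSec_bot]; simp
  · rw [unitSec_of_ne h]; simp

theorem res_mem (D : FinDivisor) {U V : Opens SpecZBar} (h : U ≤ V) {q : ℚ}
    (hq : q ∈ finSections D V) : unitSec U * q ∈ finSections D U := by
  by_cases hU : U = ⊥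
  · rw [hU, unitSec_bot, zero_mul]; exact zero_mem _
  · rw [unitSec_of_ne hU, one_mul]
    exact ⟨fun p hp => hq.1 p (h hp), fun h' => absurd h' hU⟩

/-! ## The Γ-set `Hℚ` -/

/-- `Hℚ(f)(φ)(j) = ∑ φ(i)` over the `i` with `f(i) = j`. -/
def push {m n : GammaOp} (f : m ⟶ n) (φ : Fin m.card → ℚ) : Fin n.card → ℚ :=
  fun j => ∑ i, if PMap.toFun f (some i) = some j then φ i else 0

/-- The image of `(i, j) ↦ φ(i) ψ(j)` under `v : m₊ ∧ n₊ → k₊`. -/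
def prod {m n k : GammaOp} (φ : Fin m.card → ℚ) (ψ : Fin n.card → ℚ) (v : SmashMap m n k) :
    Fin k.card → ℚ :=
  fun l => ∑ i, ∑ j, if v.toFun (some i) (some j) = some l then φ i * ψ j else 0

/-- The function `e δ_c`. -/
def delta (e : ℚ) {n : GammaOp} (c : n.Pt) : Fin n.card → ℚ :=
  fun i => if c = some i then e else 0

/-- The sum `∑ |φ(i)|`. -/
noncomputable def sumAbs {n : GammaOp} (φ : Fin n.card → ℚ) : ℝ := ∑ i, |((φ i : ℚ) : ℝ)|

theorem sum_ite_some {R : Type} [AddCommMonoid R] {n : GammaOp} (o : n.Pt) (F : n.Pt → R)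
    (h : F none = 0) : (∑ l, if o = some l then F (some l) else 0) = F o := by
  cases o with
  | none => simp [h]
  | some c => simp

/-- The pairing `∑ φ(i) F(i)`. -/
def pair {n : GammaOp} (φ : Fin n.card → ℚ) (F : n.Pt → ℚ) : ℚ := ∑ i, φ i * F (some i)

theorem pair_ext {n : GammaOp} {φ ψ : Fin n.card → ℚ}
    (h : ∀ F : n.Pt → ℚ, F none = 0 → pair φ F = pair ψ F) : φ = ψ := by
  funext i
  have := h (fun o => if o = some i then 1 else 0) (by simp)
  simpa [pair] using this

theorem pair_push {m n : GammaOp} (f : m ⟶ n) (φ : Fin m.card → ℚ) (F : n.Pt → ℚ)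
    (h : F none = 0) : pair (push f φ) F = pair φ (fun x => F (PMap.toFun f x)) := by
  simp only [pair, push, Finset.sum_mul]
  rw [Finset.sum_comm]
  refine Finset.sum_congr rfl fun i _ => ?_
  rw [← sum_ite_some (PMap.toFun f (some i)) (fun o => φ i * F o) (by simp [h])]
  refine Finset.sum_congr rfl fun l _ => ?_
  split_ifs <;> simp

theorem pair_prod {m n k : GammaOp} (φ : Fin m.card → ℚ) (ψ : Fin n.card → ℚ)
    (v : SmashMap m n k) (F : k.Pt → ℚ) (h : F none = 0) :
    pair (prod φ ψ v) F = pair φ (fun x => pair ψ (fun y => F (v.toFun x y))) := by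
  simp only [pair, prod, Finset.sum_mul, Finset.mul_sum]
  rw [Finset.sum_comm]
  refine Finset.sum_congr rfl fun i _ => ?_
  rw [Finset.sum_comm]
  refine Finset.sum_congr rfl fun j _ => ?_
  rw [← mul_assoc, ← sum_ite_some (v.toFun (some i) (some j)) (fun o => φ i * ψ j * F o)
    (by simp [h])]
  refine Finset.sum_congr rfl fun l _ => ?_
  split_ifs <;> simp

theorem pair_delta (e : ℚ) {n : GammaOp} (c : n.Pt) (F : n.Pt → ℚ) (h : F none = 0) :
    pair (delta e c) F = e * F c := by
  rw [← sum_ite_some c (fun o => e * F o) (by simp [h])]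
  refine Finset.sum_congr rfl fun l _ => ?_
  simp only [delta]
  split_ifs <;> simp

theorem pair_mul (e : ℚ) {n : GammaOp} (φ : Fin n.card → ℚ) (F : n.Pt → ℚ) :
    pair (fun i => e * φ i) F = e * pair φ F := by
  simp [pair, Finset.mul_sum, mul_assoc]

theorem pair_zero {n : GammaOp} (φ : Fin n.card → ℚ) : pair φ (fun _ => 0) = 0 := by simp [pair]

theorem pair_comm {m n : GammaOp} (φ : Fin m.card → ℚ) (ψ : Fin n.card → ℚ)
    (F : m.Pt → n.Pt → ℚ) :
    pair φ (fun x => pair ψ (fun y => F x y)) = pair ψ (fun y => pair φ (fun x => F x y)) := by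
  simp only [pair, Finset.mul_sum]
  rw [Finset.sum_comm]
  refine Finset.sum_congr rfl fun i _ => Finset.sum_congr rfl fun j _ => by ring

theorem push_id {n : GammaOp} (φ : Fin n.card → ℚ) : push (𝟙 n) φ = φ :=
  pair_ext fun F hF => by rw [pair_push _ _ _ hF]; rfl

theorem push_comp {m n k : GammaOp} (f : m ⟶ n) (g : n ⟶ k) (φ : Fin m.card → ℚ) :
    push (f ≫ g) φ = push g (push f φ) :=
  pair_ext fun F hF => by
    rw [pair_push _ _ _ hF, pair_push _ _ _ hF, pair_push _ _ _ (by rw [PMap.map_none, hF])]; rfl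

theorem prod_push {m n m' n' k : GammaOp} (f : m ⟶ m') (g : n ⟶ n') (v : SmashMap m' n' k)
    (φ : Fin m.card → ℚ) (ψ : Fin n.card → ℚ) :
    prod (push f φ) (push g ψ) v = prod φ ψ (v.pre f g) :=
  pair_ext fun F hF => by
    rw [pair_prod _ _ _ _ hF, pair_prod _ _ _ _ hF, pair_push]
    · congr 1; funext x
      rw [pair_push _ _ _ (by rw [v.right_none, hF])]; rfl
    · simp [v.left_none, hF, pair_zero]

theorem push_prod {m n k k' : GammaOp} (v : SmashMap m n k) (h : k ⟶ k')
    (φ : Fin m.card → ℚ) (ψ : Fin n.card → ℚ) : push h (prod φ ψ v) = prod φ ψ (v.post h) :=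
  pair_ext fun F hF => by
    rw [pair_push _ _ _ hF, pair_prod _ _ _ _ hF, pair_prod _ _ _ _ (by rw [PMap.map_none, hF])]
    rfl

theorem prod_delta (e : ℚ) {m n k : GammaOp} (v : SmashMap m n k) (c : m.Pt)
    (ψ : Fin n.card → ℚ) (h : ∀ i, e * ψ i = ψ i) :
    prod (delta e c) ψ v = push (v.slice c) ψ :=
  pair_ext fun F hF => by
    rw [pair_prod _ _ _ _ hF, pair_delta, pair_push _ _ _ hF, ← pair_mul]
    · simp only [h]; rfl
    · simp [v.left_none, hF, pair_zero]

theorem prod_assoc {l m n p p' q : GammaOp} (v : SmashMap l m p) (w : SmashMap p n q)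
    (v' : SmashMap m n p') (w' : SmashMap l p' q)
    (h : ∀ c x y, w.toFun (v.toFun c x) y = w'.toFun c (v'.toFun x y))
    (φ : Fin l.card → ℚ) (ψ : Fin m.card → ℚ) (χ : Fin n.card → ℚ) :
    prod (prod φ ψ v) χ w = prod φ (prod ψ χ v') w' :=
  pair_ext fun F hF => by
    rw [pair_prod _ _ _ _ hF, pair_prod _ _ _ _ hF, pair_prod]
    · congr 1; funext x
      rw [pair_prod _ _ _ _ (by rw [w'.right_none, hF])]
      simp only [h]
    · simp [w.left_none, hF, pair_zero]

theorem prod_comm {m n k : GammaOp} (v : SmashMap m n k) (φ : Fin m.card → ℚ)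
    (ψ : Fin n.card → ℚ) : prod φ ψ v = prod ψ φ v.swap :=
  pair_ext fun F hF => by
    rw [pair_prod _ _ _ _ hF, pair_prod _ _ _ _ hF, pair_comm]; rfl

theorem push_mul (e : ℚ) {m n : GammaOp} (f : m ⟶ n) (φ : Fin m.card → ℚ) :
    push f (fun i => e * φ i) = fun j => e * push f φ j :=
  pair_ext fun F hF => by
    rw [pair_push _ _ _ hF, pair_mul, pair_mul, pair_push _ _ _ hF]

theorem prod_mul (e : ℚ) (he : e * e = e) {m n k : GammaOp} (v : SmashMap m n k)
    (φ : Fin m.card → ℚ) (ψ : Fin n.card → ℚ) :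
    prod (fun i => e * φ i) (fun i => e * ψ i) v = fun j => e * prod φ ψ v j :=
  pair_ext fun F hF => by
    rw [pair_prod _ _ _ _ hF, pair_mul, pair_mul, pair_prod _ _ _ _ hF, ← pair_mul]
    simp only [pair, Finset.mul_sum]
    refine Finset.sum_congr rfl fun i _ => Finset.sum_congr rfl fun j _ => ?_
    linear_combination (φ i * (ψ j * F (v.toFun (some i) (some j)))) * he

theorem delta_map (e : ℚ) {m n : GammaOp} (f : m ⟶ n) (c : m.Pt) :
    delta e (PMap.toFun f c) = push f (delta e c) :=
  pair_ext fun F hF => by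
    rw [pair_push _ _ _ hF, pair_delta _ _ _ hF, pair_delta _ _ _ (by rw [PMap.map_none, hF])]

theorem sum_ite_some_le {n : GammaOp} (o : n.Pt) (t : ℝ) (ht : 0 ≤ t) :
    (∑ l, if o = some l then t else 0) ≤ t := by
  cases o with
  | none => simpa using ht
  | some c => simp

theorem sumAbs_nonneg {n : GammaOp} (φ : Fin n.card → ℚ) : 0 ≤ sumAbs φ :=
  Finset.sum_nonneg fun _ _ => abs_nonneg _

theorem sumAbs_push_le {m n : GammaOp} (f : m ⟶ n) (φ : Fin m.card → ℚ) :
    sumAbs (push f φ) ≤ sumAbs φ := by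
  calc sumAbs (push f φ)
      ≤ ∑ j, ∑ i, if PMap.toFun f (some i) = some j then |((φ i : ℚ) : ℝ)| else 0 := by
        refine Finset.sum_le_sum fun j _ => ?_
        rw [push, Rat.cast_sum]
        refine (Finset.abs_sum_le_sum_abs _ _).trans (Finset.sum_le_sum fun i _ => ?_)
        split_ifs <;> simp
    _ ≤ sumAbs φ := by
        rw [Finset.sum_comm]
        exact Finset.sum_le_sum fun i _ => sum_ite_some_le _ _ (abs_nonneg _)

theorem sumAbs_prod_le {m n k : GammaOp} (v : SmashMap m n k) (φ : Fin m.card → ℚ)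
    (ψ : Fin n.card → ℚ) : sumAbs (prod φ ψ v) ≤ sumAbs φ * sumAbs ψ := by
  calc sumAbs (prod φ ψ v)
      ≤ ∑ l, ∑ i, ∑ j, if v.toFun (some i) (some j) = some l
          then |((φ i : ℚ) : ℝ)| * |((ψ j : ℚ) : ℝ)| else 0 := by
        refine Finset.sum_le_sum fun l _ => ?_
        rw [prod, Rat.cast_sum]
        refine (Finset.abs_sum_le_sum_abs _ _).trans (Finset.sum_le_sum fun i _ => ?_)
        rw [Rat.cast_sum]
        refine (Finset.abs_sum_le_sum_abs _ _).trans (Finset.sum_le_sum fun j _ => ?_)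
        split_ifs <;> simp [abs_mul]
    _ ≤ sumAbs φ * sumAbs ψ := by
        rw [Finset.sum_comm, sumAbs, sumAbs, Finset.sum_mul_sum]
        refine Finset.sum_le_sum fun i _ => ?_
        rw [Finset.sum_comm]
        exact Finset.sum_le_sum fun j _ => sum_ite_some_le _ _ (by positivity)

theorem sumAbs_delta_le (e : ℚ) (he : |e| ≤ 1) {n : GammaOp} (c : n.Pt) :
    sumAbs (delta e c) ≤ 1 := by
  have he' : |(e : ℝ)| ≤ 1 := by exact_mod_cast he
  refine le_trans ?_ ((sum_ite_some_le c |(e : ℝ)| (abs_nonneg _)).trans he')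
  refine Finset.sum_le_sum fun i _ => ?_
  rw [delta]
  split_ifs <;> simp

theorem sumAbs_mul_le (e : ℚ) (he : |e| ≤ 1) {n : GammaOp} (φ : Fin n.card → ℚ) :
    sumAbs (n := n) (fun i => e * φ i) ≤ sumAbs φ := by
  have he' : |(e : ℝ)| ≤ 1 := by exact_mod_cast he
  refine Finset.sum_le_sum fun i _ => ?_
  rw [Rat.cast_mul, abs_mul]
  exact mul_le_of_le_one_left (abs_nonneg _) he'

/-! ## The structure sheaf and the sheaves `O(D)` -/

/-- The elements of `‖H O(D)(U ∩ Spec ℤ)‖_B (k₊)`: the `φ` in `H O(D)(U ∩ Spec ℤ)(k₊)` that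
satisfy moreover, if `∞ ∈ U`, the condition `∑ |φ(i)| ∈ B`. The lower set `B` is
`{t | t ≤ λ}` or `{t | t < λ}`. -/
@[ext]
structure NormSec (D : FinDivisor) (B : LowerSet ℝ) (U : Opens SpecZBar) (k : GammaOp) where
  /-- the underlying element of `Hℚ(k₊)` -/
  val : Fin k.card → ℚ
  mem : ∀ i, val i ∈ finSections D U
  bound : SpecZPt.infty ∈ U → sumAbs val ∈ B

section NormSheaf

variable (D : FinDivisor) (B : LowerSet ℝ) (hB : (0 : ℝ) ∈ B)

/-- The Γ-set of the sections over `U`. -/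
def normGamma (U : Opens SpecZBar) : GammaSet where
  obj k := Pointed.of (⟨fun _ => 0, fun _ => zero_mem _, fun _ => by simpa [sumAbs] using hB⟩ :
    NormSec D B U k)
  map f := ⟨fun φ => ⟨push f φ.val, fun j => sum_mem fun i _ => by
      split_ifs
      · exact φ.mem i
      · exact zero_mem _, fun h => B.lower (sumAbs_push_le f φ.val) (φ.bound h)⟩, by
      apply NormSec.ext; funext j; simp [push]⟩
  map_id k := by
    apply Pointed.Hom.ext; funext φ; exact NormSec.ext (push_id _)
  map_comp f g := by
    apply Pointed.Hom.ext; funext φ; exact NormSec.ext (push_comp f g _)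
  subsingleton_zero := ⟨fun φ ψ => NormSec.ext (funext fun i => i.elim0)⟩

variable {D B} in
/-- The product of a section of `O` and a section of a sheaf `‖H O(D)‖_B`. -/
def normMul {U : Opens SpecZBar} {m n k : GammaOp} (a : NormSec 0 (LowerSet.Iic 1) U m)
    (x : NormSec D B U n) (v : SmashMap m n k) : NormSec D B U k where
  val := prod a.val x.val v
  mem l := sum_mem fun i _ => sum_mem fun j _ => by
    split_ifs
    · simpa using finSections_mul (a.mem i) (x.mem j)
    · exact zero_mem _
  bound h := B.lower ((sumAbs_prod_le v a.val x.val).trans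
    (mul_le_of_le_one_left (sumAbs_nonneg _) (a.bound h))) (x.bound h)

variable {D B} in
/-- The restriction of sections. -/
noncomputable def normRes {U V : Opens SpecZBar} (h : U ≤ V) {k : GammaOp} (x : NormSec D B V k) :
    NormSec D B U k where
  val i := unitSec U * x.val i
  mem i := res_mem D h (x.mem i)
  bound hU := B.lower (sumAbs_mul_le _ (abs_unitSec_le U) _) (x.bound (h hU))

theorem zero_mem_Iic_one : (0 : ℝ) ∈ LowerSet.Iic (1 : ℝ) := zero_le_one (α := ℝ)

/-- The `𝕊`-algebra `O(U) = ‖H O(U ∩ Spec ℤ)‖_1` (and `H O(U)` if `∞ ∉ U`). -/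
noncomputable def structAlg (U : Opens SpecZBar) : CommSAlg where
  toGammaSet := normGamma 0 (LowerSet.Iic 1) zero_mem_Iic_one U
  one :=
    { app := fun n => ⟨fun c => ⟨delta (unitSec U) c, fun i => by
          unfold delta
          split_ifs
          · exact unitSec_mem U
          · exact zero_mem _, fun _ => sumAbs_delta_le _ (abs_unitSec_le U) c⟩, by
          apply NormSec.ext; funext i; rfl⟩
      naturality := fun m n f => by
        apply Pointed.Hom.ext; funext c; exact NormSec.ext (delta_map _ f c) }
  mul a b v := normMul a b v
  mul_map f g v a b := NormSec.ext (prod_push f g v _ _)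
  map_mul v h a b := NormSec.ext (push_prod v h _ _)
  one_mul v c b := NormSec.ext (prod_delta _ v c _ fun i => unitSec_mul (b.mem i))
  mul_assoc v w v' w' h a b c := NormSec.ext (prod_assoc v w v' w' h _ _ _)
  mul_comm v a b := NormSec.ext (prod_comm v _ _)

/-- The restriction maps as morphisms of Γ-sets. -/
noncomputable def normResNat {U V : Opens SpecZBar} (h : U ≤ V) :
    (normGamma D B hB V).toFunctor ⟶ (normGamma D B hB U).toFunctor where
  app k := ⟨fun x => normRes h x, by apply NormSec.ext; funext i; exact mul_zero _⟩
  naturality _ _ f := by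
    apply Pointed.Hom.ext; funext x; exact NormSec.ext (push_mul _ f _).symm

theorem normResNat_self (U : Opens SpecZBar) : normResNat D B hB (le_refl U) = 𝟙 _ := by
  apply NatTrans.ext; funext k; apply Pointed.Hom.ext; funext x
  exact NormSec.ext (funext fun i => unitSec_mul (NormSec.mem x i))

theorem normResNat_comp {U V W : Opens SpecZBar} (h : U ≤ V) (h' : V ≤ W) :
    normResNat D B hB h' ≫ normResNat D B hB h = normResNat D B hB (h.trans h') := by
  apply NatTrans.ext; funext k; apply Pointed.Hom.ext; funext x
  refine NormSec.ext (funext fun i => ?_)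
  change unitSec U * (unitSec V * NormSec.val x i) = unitSec U * NormSec.val x i
  rw [← mul_assoc, unitSec_mul_unitSec h]

/-- The structure sheaf `O` of `Spec ℤ ∪ {∞}`. Its underlying presheaf of Γ-sets is that of
`normPresheaf 0 (LowerSet.Iic 1)` below, hence a sheaf by `normPresheaf_isSheaf`. -/
noncomputable def structSheaf : TopCat.Presheaf CommSAlg SpecZBar where
  obj U := structAlg U.unop
  map {V U} h :=
    { nat := normResNat 0 (LowerSet.Iic 1) zero_mem_Iic_one (leOfHom h.unop)
      map_one := by
        apply NatTrans.ext; funext k; apply Pointed.Hom.ext; funext c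
        refine NormSec.ext (funext fun i => ?_)
        change unitSec U.unop * delta (unitSec V.unop) c i = delta (unitSec U.unop) c i
        simp only [delta]
        split_ifs
        · exact unitSec_mul_unitSec (leOfHom h.unop)
        · exact mul_zero _
      map_mul := fun v a b =>
        NormSec.ext (prod_mul _ (unitSec_mul_unitSec le_rfl) v _ _).symm }
  map_id U := CommSAlg.Hom.ext (normResNat_self 0 _ _ U.unop)
  map_comp f g := CommSAlg.Hom.ext (normResNat_comp 0 _ _ (leOfHom g.unop) (leOfHom f.unop)).symm

/-- The presheaf of `O`-modules `‖H O(D)‖_B`. -/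
noncomputable def normPresheaf : PresheafOfSMod structSheaf where
  obj U :=
    { toGammaSet := normGamma D B hB U
      act := fun a x v => normMul a x v
      act_map := fun f g v _ _ => NormSec.ext (prod_push f g v _ _)
      map_act := fun v h _ _ => NormSec.ext (push_prod v h _ _)
      one_act := fun v c x => NormSec.ext (prod_delta _ v c _ fun i => unitSec_mul (NormSec.mem x i))
      mul_act := fun v w v' w' h _ _ _ => NormSec.ext (prod_assoc v w v' w' h _ _ _) }
  res h := normResNat D B hB h
  res_self U := normResNat_self D B hB U
  res_res h h' := normResNat_comp D B hB h h'
  res_act _ _ _ _ v _ _ := NormSec.ext (prod_mul _ (unitSec_mul_unitSec le_rfl) v _ _).symm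

theorem normPresheaf_isSheaf : (normPresheaf D B hB).IsSheaf := by
  intro ι U n s hs
  have hs' : ∀ i j, U i ≠ ⊥ → U j ≠ ⊥ → NormSec.val (s i) = NormSec.val (s j) := by
    intro i j hi hj
    have hij : U i ⊓ U j ≠ ⊥ := fun h => by
      have : SpecZPt.generic ∈ U i ⊓ U j := ⟨generic_mem hi, generic_mem hj⟩
      rw [h] at this
      exact this
    have e := congrArg NormSec.val (hs i j)
    funext l
    have e' := congrFun e l
    change unitSec (U i ⊓ U j) * NormSec.val (s i) l =
      unitSec (U i ⊓ U j) * NormSec.val (s j) l at e'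
    rwa [unitSec_of_ne hij, one_mul, one_mul] at e'
  have bot_zero : ∀ (V : Opens SpecZBar) (x y : NormSec D B V n), V = ⊥ → x = y := by
    intro V x y hV
    refine NormSec.ext (funext fun i => ?_)
    rw [(x.mem i).2 hV, (y.mem i).2 hV]
  by_cases hne : ∃ i, U i ≠ ⊥
  · obtain ⟨i, hi⟩ := hne
    have hU : (⨆ i, U i) ≠ ⊥ := fun h => hi (le_bot_iff.1 (h ▸ le_iSup U i))
    have val_res : ∀ (t : NormSec D B (⨆ i, U i) n) (j : ι), U j ≠ ⊥ →
        NormSec.val (evalAt ((normPresheaf D B hB).res (le_iSup U j)) t) = t.val := by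
      intro t j hj
      funext l
      change unitSec (U j) * t.val l = t.val l
      rw [unitSec_of_ne hj, one_mul]
    have hval : ∀ (q : SpecZPt) (j : ι), q ∈ U j → NormSec.val (s i) = NormSec.val (s j) := by
      intro q j hq
      refine hs' i j hi fun h => ?_
      rw [h] at hq
      exact hq
    refine ⟨(⟨NormSec.val (s i), fun l => ⟨fun p hp => ?_, fun h => absurd h hU⟩, fun h => ?_⟩ :
      NormSec D B (⨆ i, U i) n), fun j => ?_, fun t ht => ?_⟩
    · obtain ⟨j, hj⟩ := Opens.mem_iSup.1 hp
      rw [hval _ j hj]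
      exact (NormSec.mem (s j) l).1 p hj
    · obtain ⟨j, hj⟩ := Opens.mem_iSup.1 h
      rw [hval _ j hj]
      exact NormSec.bound (s j) hj
    · by_cases hj : U j = ⊥
      · exact bot_zero _ _ _ hj
      · exact NormSec.ext ((val_res _ j hj).trans (hs' i j hi hj))
    · refine NormSec.ext ?_
      rw [← val_res t i hi, ht i]
  · push Not at hne
    have hU : (⨆ i, U i) = ⊥ := by rw [iSup_eq_bot]; exact hne
    exact ⟨((normPresheaf D B hB).obj _).obj n |>.point, fun i => bot_zero _ _ _ (hne i),
      fun t _ => bot_zero _ _ _ hU⟩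

/-- The sheaf of `O`-modules `‖H O(D)‖_B`. -/
noncomputable def normSheaf : SheafOfSMod structSheaf :=
  ⟨normPresheaf D B hB, normPresheaf_isSheaf D B hB⟩

end NormSheaf

/-- The sheaf of `O`-modules `O(D)` of an Arakelov divisor `D = (D_finite, a)`:
`O(D)(U) = ‖H O(D_finite)(U ∩ Spec ℤ)‖_{e^a}` for `∞ ∈ U`, and `H O(D_finite)(U)` otherwise. -/
noncomputable def sheafO (D : ArakelovDivisor) : SheafOfSMod structSheaf :=
  normSheaf D.1 (LowerSet.Iic (Real.exp D.2)) (Real.exp_nonneg _)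

/-- The sheaf `O_ε`, with `O_ε(U) = ‖H O(U ∩ Spec ℤ)‖_{<1}` for `∞ ∈ U`, and `H O(U)` otherwise. -/
noncomputable def sheafEps : SheafOfSMod structSheaf :=
  normSheaf 0 (LowerSet.Iio 1) (zero_lt_one (α := ℝ))

/-- The bilinear maps `O(D)(U)(m₊) × O(D')(U)(n₊) → O(D + D')(U)(k₊)`, for `v : m₊ ∧ n₊ → k₊`,
given by the product of `ℚ`. -/
noncomputable def mulSec {D D' : ArakelovDivisor} {U : Opens SpecZBar} {m n k : GammaOp}
    (x : ((sheafO D).obj.obj U).obj m) (y : ((sheafO D').obj.obj U).obj n) (v : SmashMap m n k) :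
    ((sheafO (D + D')).obj.obj U).obj k :=
  (⟨prod (NormSec.val x) (NormSec.val y) v, fun _ => sum_mem fun i _ => sum_mem fun j _ => by
    split_ifs
    · exact finSections_mul (NormSec.mem x i) (NormSec.mem y j)
    · exact zero_mem _, fun h => by
    have hx : sumAbs (NormSec.val x) ≤ Real.exp D.2 := NormSec.bound x h
    have hy : sumAbs (NormSec.val y) ≤ Real.exp D'.2 := NormSec.bound y h
    change sumAbs _ ≤ Real.exp (D.2 + D'.2)
    rw [Real.exp_add]
    exact (sumAbs_prod_le v _ _).trans
      (mul_le_mul hx hy (sumAbs_nonneg _) (Real.exp_nonneg _))⟩ :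
    NormSec (D.1 + D'.1) (LowerSet.Iic (Real.exp (D.2 + D'.2))) U k)

/-- The exceptional case: `e^a` and `e^{a'}` are irrational and their product is rational. -/
def Exceptional (D D' : ArakelovDivisor) : Prop :=
  Irrational (Real.exp D.2) ∧ Irrational (Real.exp D'.2) ∧
    ¬ Irrational (Real.exp D.2 * Real.exp D'.2)

/-- Equivalence of Arakelov divisors modulo principal divisors. -/
def PrincipallyEquivalent (D D' : ArakelovDivisor) : Prop :=
  ∃ q : ℚˣ, D' - D = principal q

end GammaArith

open GammaArith

/-!
Near each point a divisor on `Spec ℤ` is principal, and a generator `r` of `O(D)` near `∞` can be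
any positive rational number, since every prime may be removed by shrinking. Every section `z` of
the sheaf of products thus splits locally as `r ∧ (r⁻¹ z)`, and two elements of `O(D) ∧ O(D')` with
the same product agree locally, because the factor `r⁻¹ x` of `x = r (r⁻¹ x)` can be moved across
the smash product. So `O(D) ∧ O(D')` is the sheaf attached to `D + D'` whose norm bound consists of
the products `s t` of rational numbers `s ≤ e ^ a` and `t ≤ e ^ a'`. As the sums `∑ |φ(i)|` are
rational, this bound differs from `≤ e ^ (a + a')` only if `e ^ (a + a')` is rational but not such a
product, in which case it is `< e ^ (a + a')`.

Away from `∞` the integers act on `O(D)`, so a morphism between these sheaves multiplies all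
sections by one rational number, which has to respect both the divisors and the norm bounds.
-/

namespace GammaArith

/-! ## Locally bijective morphisms -/

theorem GammaSet.map_point_of_natural {M N : GammaSet}
    (φ : ∀ k : GammaOp, M.obj k → N.obj k)
    (hφ : ∀ {k k' : GammaOp} (g : k ⟶ k') (x : M.obj k), φ k' (M.mp g x) = N.mp g (φ k x))
    (k : GammaOp) : φ k (M.obj k).point = (N.obj k).point := by
  let z : (⟨0⟩ : GammaOp) ⟶ k := ⟨fun _ => none, rfl⟩
  have h₀ : φ ⟨0⟩ (M.obj ⟨0⟩).point = (N.obj ⟨0⟩).point := N.subsingleton_zero.elim _ _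
  rw [← M.mp_point z, hφ, h₀, N.mp_point]

namespace PresheafOfSMod

variable {X : TopCat.{0}} {O : TopCat.Presheaf CommSAlg X} {M N : PresheafOfSMod O}

theorem Hom.app_res_apply (f : M ⟶ N) {U V : Opens X} (h : U ≤ V) {k : GammaOp}
    (x : (M.obj V).obj k) :
    evalAt (Hom.app f U) (evalAt (M.res h) x) = evalAt (N.res h) (evalAt (Hom.app f V) x) :=
  congrArg (fun φ : (M.obj V).toFunctor ⟶ (N.obj U).toFunctor => evalAt φ x)
    (Hom.app_res f h).symm

theorem hom_ext_apply {f g : M ⟶ N}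
    (h : ∀ (U : Opens X) (k : GammaOp) (x : (M.obj U).obj k),
      evalAt (Hom.app f U) x = evalAt (Hom.app g U) x) : f = g :=
  Hom.ext <| funext fun U => NatTrans.ext <| funext fun k => Pointed.Hom.ext <| funext <| h U k

/-- A morphism of presheaves of modules from its maps on sections. They respect the base points
because the sections at level `0₊` do. -/
def homMk (φ : ∀ (U : Opens X) (k : GammaOp), (M.obj U).obj k → (N.obj U).obj k)
    (map : ∀ (U : Opens X) {k k' : GammaOp} (g : k ⟶ k') (x : (M.obj U).obj k),
      φ U k' ((M.obj U).mp g x) = (N.obj U).mp g (φ U k x))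
    (res : ∀ {U V : Opens X} (h : U ≤ V) {k : GammaOp} (x : (M.obj V).obj k),
      φ U k (evalAt (M.res h) x) = evalAt (N.res h) (φ V k x))
    (act : ∀ (U : Opens X) {m n k : GammaOp} (v : SmashMap m n k)
      (a : (O.obj (op U)).obj m) (x : (M.obj U).obj n),
      φ U k ((M.obj U).act a x v) = (N.obj U).act a (φ U n x) v) : M ⟶ N where
  app U :=
    { app := fun k => ⟨φ U k, GammaSet.map_point_of_natural (φ U) (map U) k⟩
      naturality := fun _ _ g => Pointed.Hom.ext (funext (map U g)) }
  app_res h := NatTrans.ext (funext fun _ => Pointed.Hom.ext (funext fun x => (res h x).symm))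
  app_act := act

/-- The isomorphism defined by a morphism that is bijective on sections. -/
noncomputable def isoOfBijective (f : M ⟶ N)
    (hf : ∀ (U : Opens X) (k : GammaOp), Function.Bijective (evalAt (Hom.app f U) (n := k))) :
    M ≅ N where
  hom := f
  inv := homMk (fun U k => Function.surjInv (hf U k).surjective)
    (fun U k k' _ _ => (hf U k').injective (by
      rw [evalAt_map, Function.surjInv_eq (hf U k').surjective,
        Function.surjInv_eq (hf U k).surjective]))
    (fun {U V} h k _ => (hf U k).injective (by
      rw [Hom.app_res_apply, Function.surjInv_eq (hf U k).surjective,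
        Function.surjInv_eq (hf V k).surjective]))
    (fun U _ n k _ _ _ => (hf U k).injective (by
      rw [Hom.app_act, Function.surjInv_eq (hf U k).surjective,
        Function.surjInv_eq (hf U n).surjective]))
  hom_inv_id := hom_ext_apply fun U k => Function.leftInverse_surjInv (hf U k)
  inv_hom_id := hom_ext_apply fun U k => Function.rightInverse_surjInv (hf U k).surjective

theorem isoOfBijective_inv_apply (f : M ⟶ N)
    (hf : ∀ (U : Opens X) (k : GammaOp), Function.Bijective (evalAt (Hom.app f U) (n := k)))
    {U : Opens X} {k : GammaOp} (x : (M.obj U).obj k) :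
    evalAt (Hom.app (isoOfBijective f hf).inv U) (evalAt (Hom.app f U) x) = x :=
  Function.leftInverse_surjInv (hf U k) x

theorem germ_eq_iff {U V : Opens X} {p : X} (hU : p ∈ U) (hV : p ∈ V) {k : GammaOp}
    {s : (M.obj U).obj k} {t : (M.obj V).obj k} :
    (germ hU s : M.Stalk p k) = germ hV t ↔ ∃ (W : Opens X) (hs : W ≤ U) (ht : W ≤ V), p ∈ W ∧
      evalAt (M.res hs) s = evalAt (M.res ht) t :=
  Quotient.eq

theorem exists_germ_eq {p : X} {k : GammaOp} (s : M.Stalk p k) :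
    ∃ (U : Opens X) (hp : p ∈ U) (x : (M.obj U).obj k), s = germ hp x := by
  obtain ⟨⟨U, hp, x⟩, rfl⟩ := Quotient.exists_rep s
  exact ⟨U, hp, x, rfl⟩

/-- The map induced on stalks by a morphism of presheaves of modules. -/
def stalkHom (f : M ⟶ N) (p : X) (k : GammaOp) : M.Stalk p k → N.Stalk p k :=
  Quotient.lift (fun s => germ s.mem (evalAt (Hom.app f s.U) s.s)) (by
    rintro s t ⟨W, hs, ht, hpW, e⟩
    rw [← N.germ_res hs hpW, ← N.germ_res ht hpW, ← Hom.app_res_apply, ← Hom.app_res_apply, e])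

theorem stalkHom_germ (f : M ⟶ N) {U : Opens X} {p : X} (hp : p ∈ U) {k : GammaOp}
    (s : (M.obj U).obj k) : stalkHom f p k (germ hp s) = germ hp (evalAt (Hom.app f U) s) :=
  rfl

theorem stalkHom_stalkMap (f : M ⟶ N) (p : X) {k k' : GammaOp} (g : k ⟶ k') (s : M.Stalk p k) :
    stalkHom f p k' (M.stalkMap p g s) = N.stalkMap p g (stalkHom f p k s) := by
  obtain ⟨U, hp, x, rfl⟩ := exists_germ_eq s
  exact congrArg (germ hp) (evalAt_map (Hom.app f U) g x)

theorem stalkHom_stalkAct (f : M ⟶ N) {p : X} {U : Opens X} (hp : p ∈ U) {m n k : GammaOp}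
    (a : (O.obj (op U)).obj m) (s : M.Stalk p n) (v : SmashMap m n k) :
    stalkHom f p k (M.stalkAct hp a s v) = N.stalkAct hp a (stalkHom f p n s) v := by
  obtain ⟨V, hV, x, rfl⟩ := exists_germ_eq s
  have hpW : p ∈ U ⊓ V := ⟨hp, hV⟩
  rw [M.stalkAct_germ hp hV hpW inf_le_left inf_le_right, stalkHom_germ, stalkHom_germ,
    N.stalkAct_germ hp hV hpW inf_le_left inf_le_right, Hom.app_act, Hom.app_res_apply]

/-- A morphism is locally injective if sections with the same image agree locally. -/
def LocallyInjective (f : M ⟶ N) : Prop :=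
  ∀ (U : Opens X) (k : GammaOp) (s t : (M.obj U).obj k),
    evalAt (Hom.app f U) s = evalAt (Hom.app f U) t →
    ∀ p ∈ U, ∃ (W : Opens X) (h : W ≤ U), p ∈ W ∧ evalAt (M.res h) s = evalAt (M.res h) t

/-- A morphism is locally surjective if every section of its target lifts locally. -/
def LocallySurjective (f : M ⟶ N) : Prop :=
  ∀ (U : Opens X) (k : GammaOp) (t : (N.obj U).obj k),
    ∀ p ∈ U, ∃ (W : Opens X) (h : W ≤ U) (_ : p ∈ W) (s : (M.obj W).obj k),
      evalAt (Hom.app f W) s = evalAt (N.res h) t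

theorem LocallyInjective.stalkHom_injective {f : M ⟶ N} (hf : LocallyInjective f) (p : X)
    (k : GammaOp) : Function.Injective (stalkHom f p k) := by
  intro σ τ h
  obtain ⟨U, hU, s, rfl⟩ := exists_germ_eq σ
  obtain ⟨V, hV, t, rfl⟩ := exists_germ_eq τ
  obtain ⟨W, hs, ht, hpW, e⟩ := (germ_eq_iff hU hV).1 h
  rw [← Hom.app_res_apply, ← Hom.app_res_apply] at e
  obtain ⟨Z, hZ, hpZ, e'⟩ := hf W k _ _ e p hpW
  rw [M.res_res_apply, M.res_res_apply] at e'
  exact (germ_eq_iff hU hV).2 ⟨Z, _, _, hpZ, e'⟩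

theorem LocallySurjective.stalkHom_surjective {f : M ⟶ N} (hf : LocallySurjective f) (p : X)
    (k : GammaOp) : Function.Surjective (stalkHom f p k) := by
  intro τ
  obtain ⟨U, hU, t, rfl⟩ := exists_germ_eq τ
  obtain ⟨W, h, hpW, s, hs⟩ := hf U k t p hU
  exact ⟨germ hpW s, by rw [stalkHom_germ, hs, N.germ_res]⟩

/-- The morphism of associated sheaves induced by a morphism of presheaves of modules. -/
def shMap (f : M ⟶ N) : M.shPresheaf ⟶ N.shPresheaf :=
  homMk
    (fun U k s => (⟨fun p hp => stalkHom f p k (ShSections.val s p hp), fun p hp => by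
      obtain ⟨V, h, hpV, t, ht⟩ := ShSections.local_germ s p hp
      exact ⟨V, h, hpV, evalAt (Hom.app f V) t, fun q hq => congrArg (stalkHom f q k) (ht q hq)⟩⟩ :
      N.ShSections U k))
    (fun _ _ _ g _ => ShSections.ext' fun p _ => stalkHom_stalkMap f p g _)
    (fun _ _ _ => rfl)
    (fun _ _ _ _ v a _ => ShSections.ext' fun _ hp => stalkHom_stalkAct f hp a _ v)

theorem shMap_bijective (f : M ⟶ N) (hf : ∀ p k, Function.Bijective (stalkHom f p k))
    (U : Opens X) (k : GammaOp) : Function.Bijective (evalAt (Hom.app (shMap f) U) (n := k)) := by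
  refine ⟨fun s t h => ShSections.ext' fun p hp => (hf p k).injective
    (congrFun (congrFun (congrArg ShSections.val h) p) hp), fun t => ?_⟩
  choose σ hσ using fun p (hp : p ∈ U) => (hf p k).surjective (ShSections.val t p hp)
  refine ⟨(⟨σ, fun p hp => ?_⟩ : M.ShSections U k), ShSections.ext' hσ⟩
  obtain ⟨V, hV, hpV, t', ht'⟩ := ShSections.local_germ t p hp
  obtain ⟨V', hV', s, hs⟩ := exists_germ_eq (σ p hp)
  have e : germ hV' (evalAt (Hom.app f V') s) = germ hpV t' := by
    rw [← stalkHom_germ, ← hs, hσ, ht' p hpV]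
  obtain ⟨W, hWV', hWV, hpW, e⟩ := (germ_eq_iff hV' hpV).1 e
  refine ⟨W, hWV.trans hV, hpW, evalAt (M.res hWV') s, fun q hq => (hf q k).injective ?_⟩
  rw [hσ, ht' q (hWV hq), stalkHom_germ, Hom.app_res_apply, e, N.germ_res]

/-- The canonical morphism from a presheaf of modules to its associated sheaf. -/
def toShHom (M : PresheafOfSMod O) : M ⟶ M.shPresheaf :=
  homMk (fun _ _ => toSh) (fun _ _ _ _ _ => rfl)
    (fun h _ x => ShSections.ext' fun _ hp => M.germ_res h hp x)
    (fun _ _ _ _ v a x => ShSections.ext' fun _ hp => by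
      change germ hp _ = M.stalkAct hp a (germ hp x) v
      rw [M.stalkAct_germ hp hp (And.intro hp hp) inf_le_left inf_le_left, ← M.res_act]
      exact (M.germ_res inf_le_left _ _).symm)

theorem toSh_eq_iff {U : Opens X} {k : GammaOp} {s t : (M.obj U).obj k} :
    toSh s = toSh t ↔ ∀ p ∈ U, ∃ (W : Opens X) (hW : W ≤ U), p ∈ W ∧
      evalAt (M.res hW) s = evalAt (M.res hW) t := by
  refine ⟨fun h p hp => ?_, fun h => ShSections.ext' fun p hp => ?_⟩
  · obtain ⟨W, hW, _, hpW, e⟩ := (germ_eq_iff hp hp).1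
      (congrFun (congrFun (congrArg ShSections.val h) p) hp)
    exact ⟨W, hW, hpW, e⟩
  · obtain ⟨W, hW, hpW, e⟩ := h p hp
    exact (germ_eq_iff hp hp).2 ⟨W, hW, hW, hpW, e⟩

theorem IsSheaf.separated (hM : M.IsSheaf) {U : Opens X} {k : GammaOp} {s t : (M.obj U).obj k}
    (h : ∀ p ∈ U, ∃ (W : Opens X) (hW : W ≤ U), p ∈ W ∧
      evalAt (M.res hW) s = evalAt (M.res hW) t) : s = t := by
  choose W hW hpW e using h
  have hle : (⨆ i : {p // p ∈ U}, W i.1 i.2) ≤ U := iSup_le fun i => hW i.1 i.2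
  have hge : U ≤ ⨆ i : {p // p ∈ U}, W i.1 i.2 := fun p hp =>
    Opens.mem_iSup.2 ⟨⟨p, hp⟩, hpW p hp⟩
  have key : evalAt (M.res hle) s = evalAt (M.res hle) t :=
    (hM {p // p ∈ U} (fun i => W i.1 i.2) k (fun i => evalAt (M.res (hW i.1 i.2)) s)
      (fun i j => by rw [M.res_res_apply, M.res_res_apply])).unique
      (fun i => M.res_res_apply _ _ _)
      (fun i => (M.res_res_apply _ _ _).trans (e i.1 i.2).symm)
  calc s = evalAt (M.res hge) (evalAt (M.res hle) s) := by
        rw [M.res_res_apply, M.res_self_apply]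
    _ = t := by rw [key, M.res_res_apply, M.res_self_apply]

theorem IsSheaf.toSh_bijective (hM : M.IsSheaf) (U : Opens X) (k : GammaOp) :
    Function.Bijective (toSh : (M.obj U).obj k → M.ShSections U k) := by
  refine ⟨fun s t h => hM.separated (toSh_eq_iff.1 h), fun σ => ?_⟩
  choose V hV hpV t ht using fun p : {p // p ∈ U} => ShSections.local_germ σ p.1 p.2
  have hle : U ≤ ⨆ i, V i := fun p hp => Opens.mem_iSup.2 ⟨⟨p, hp⟩, hpV ⟨p, hp⟩⟩
  obtain ⟨s, hs, -⟩ := hM {p // p ∈ U} V k t fun i j => hM.separated fun p hp => by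
    obtain ⟨W, hi, hj, hpW, e⟩ :=
      (germ_eq_iff hp.1 hp.2).1 ((ht i p hp.1).symm.trans (ht j p hp.2))
    exact ⟨W, le_inf hi hj, hpW, by rw [M.res_res_apply, M.res_res_apply, e]⟩
  refine ⟨evalAt (M.res hle) s, ShSections.ext' fun p hp => ?_⟩
  rw [ht ⟨p, hp⟩ p (hpV _), ← hs ⟨p, hp⟩, M.germ_res]
  exact M.germ_res hle hp s

/-- A locally bijective morphism to a sheaf identifies the sheaf associated to its source with its
target. -/
noncomputable def sheafifyIso (f : M ⟶ N) (hi : LocallyInjective f) (hs : LocallySurjective f)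
    (hN : N.IsSheaf) : M.sheafify ≅ (⟨N, hN⟩ : SheafOfSMod O) :=
  ObjectProperty.isoMk _ <|
    isoOfBijective (shMap f) (shMap_bijective f fun p k =>
      ⟨hi.stalkHom_injective p k, hs.stalkHom_surjective p k⟩) ≪≫
    (isoOfBijective (toShHom N) hN.toSh_bijective).symm

theorem sheafifyIso_toSh (f : M ⟶ N) (hi : LocallyInjective f) (hs : LocallySurjective f)
    (hN : N.IsSheaf) {U : Opens X} {k : GammaOp} (s : (M.obj U).obj k) :
    evalAt (Hom.app (sheafifyIso f hi hs hN).hom.hom U) (toSh s) = evalAt (Hom.app f U) s :=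
  isoOfBijective_inv_apply (toShHom N) hN.toSh_bijective (evalAt (Hom.app f U) s)

/-! ## Bilinear maps -/

/-- A bilinear map `M × N → P` of presheaves of modules: it attaches to sections `x` of `M(m₊)`
and `y` of `N(n₊)` and to a map `v : m₊ ∧ n₊ → k₊` a section of `P(k₊)`. These are the morphisms
out of the smash product `M ∧_O N`. -/
structure Pairing (M N P : PresheafOfSMod O) where
  toFun : ∀ {U : Opens X} {m n k : GammaOp}, (M.obj U).obj m → (N.obj U).obj n →
    SmashMap m n k → (P.obj U).obj k
  map_map : ∀ {U : Opens X} {m n m' n' k : GammaOp} (f : m ⟶ m') (g : n ⟶ n')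
    (x : (M.obj U).obj m) (y : (N.obj U).obj n) (v : SmashMap m' n' k),
    toFun ((M.obj U).mp f x) ((N.obj U).mp g y) v = toFun x y (v.pre f g)
  map_post : ∀ {U : Opens X} {m n k k' : GammaOp} (h : k ⟶ k') (x : (M.obj U).obj m)
    (y : (N.obj U).obj n) (v : SmashMap m n k),
    toFun x y (v.post h) = (P.obj U).mp h (toFun x y v)
  balance : ∀ {U : Opens X} {l m n p q k : GammaOp} (a : (O.obj (op U)).obj l)
    (x : (M.obj U).obj m) (y : (N.obj U).obj n) (r : SmashMap l m p) (w : SmashMap p n k)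
    (s : SmashMap l n q) (w' : SmashMap m q k),
    (∀ c i j, w.toFun (r.toFun c i) j = w'.toFun i (s.toFun c j)) →
    toFun ((M.obj U).act a x r) y w = toFun x ((N.obj U).act a y s) w'
  act_act : ∀ {U : Opens X} {l m n p q k : GammaOp} (a : (O.obj (op U)).obj l)
    (x : (M.obj U).obj m) (y : (N.obj U).obj n) (r : SmashMap l m p) (w : SmashMap p n k)
    (s : SmashMap m n q) (w' : SmashMap l q k),
    (∀ c i j, w.toFun (r.toFun c i) j = w'.toFun c (s.toFun i j)) →
    toFun ((M.obj U).act a x r) y w = (P.obj U).act a (toFun x y s) w'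
  res_res : ∀ {U V : Opens X} (h : U ≤ V) {m n k : GammaOp} (x : (M.obj V).obj m)
    (y : (N.obj V).obj n) (v : SmashMap m n k),
    toFun (evalAt (M.res h) x) (evalAt (N.res h) y) v = evalAt (P.res h) (toFun x y v)

variable {P : PresheafOfSMod O} (β : Pairing M N P)

theorem Pairing.eq_point_of_eq_none {U : Opens X} {m n k : GammaOp} (x : (M.obj U).obj m)
    (y : (N.obj U).obj n) (v : SmashMap m n k) (hv : ∀ i j, v.toFun i j = none) :
    β.toFun x y v = ((P.obj U).obj k).point := by
  let u : SmashMap m n ⟨0⟩ := ⟨fun _ _ => none, fun _ => rfl, fun _ => rfl⟩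
  let z : (⟨0⟩ : GammaOp) ⟶ k := ⟨fun _ => none, rfl⟩
  have hvu : v = u.post z := SmashMap.ext (funext fun i => funext fun j => hv i j)
  have h₀ : β.toFun x y u = ((P.obj U).obj ⟨0⟩).point := (P.obj U).subsingleton_zero.elim _ _
  rw [hvu, β.map_post, h₀, GammaSet.mp_point]

theorem Pairing.eq_point {U : Opens X} {m n k : GammaOp} {x : (M.obj U).obj m}
    {y : (N.obj U).obj n} (v : SmashMap m n k)
    (h : x = ((M.obj U).obj m).point ∨ y = ((N.obj U).obj n).point) :
    β.toFun x y v = ((P.obj U).obj k).point := by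
  let z (l : GammaOp) : (⟨0⟩ : GammaOp) ⟶ l := ⟨fun _ => none, rfl⟩
  rcases h with rfl | rfl
  · rw [← (M.obj U).mp_point (z m), ← (N.obj U).mp_id y, β.map_map]
    exact β.eq_point_of_eq_none _ _ _ fun _ _ => v.left_none _
  · rw [← (N.obj U).mp_point (z n), ← (M.obj U).mp_id x, β.map_map]
    exact β.eq_point_of_eq_none _ _ _ fun _ _ => v.right_none _

/-- The morphism out of the smash product presheaf defined by a bilinear map. -/
def Pairing.lift : M.smash N ⟶ P :=
  homMk
    (fun U k => Quot.lift (fun t : SmashPre (M.obj U) (N.obj U) k => β.toFun t.x t.y t.v) (by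
      rintro _ _ (⟨f, g, x, y, v⟩ | ⟨x, y, v, x', y', v', h, h'⟩ | ⟨a, x, y, r, w, s, w', h⟩)
      · exact (β.map_map f g x y v).symm
      · exact (β.eq_point v h).trans (β.eq_point v' h').symm
      · exact β.balance a x y r w s w' h))
    (by rintro U k k' g ⟨x, y, v⟩; exact β.map_post g x y v)
    (by rintro U V h k ⟨x, y, v⟩; exact β.res_res h x y v)
    (by rintro U l k k' w a ⟨x, y, v⟩; exact β.act_act a x y _ _ v w (SmashMap.assoc_univ w v))

end PresheafOfSMod

/-! ## Local generators of `O(D)` -/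

/-- The open set `Spec ℤ`, the complement of `∞`. -/
def finitePart : Opens SpecZBar :=
  ⟨{x | x ≠ SpecZPt.infty}, Or.inr ⟨by simp, (Set.finite_singleton SpecZPt.infty).subset
    fun x hx => by simpa using hx⟩⟩

/-- The complement of the support of a divisor on `Spec ℤ`; it contains `∞`. -/
def offSupport (D : FinDivisor) : Opens SpecZBar :=
  ⟨{x | ∀ p, x = SpecZPt.prime p → D p = 0}, Or.inr ⟨by simp,
    (D.hasFiniteSupport.image SpecZPt.prime).subset fun x hx => by
      simp only [Set.mem_compl_iff, Set.mem_ofPred_eq, not_forall] at hx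
      obtain ⟨p, rfl, hp⟩ := hx
      exact ⟨p, hp, rfl⟩⟩⟩

theorem mem_finitePart {x : SpecZPt} : x ∈ finitePart ↔ x ≠ SpecZPt.infty := Iff.rfl

theorem prime_mem_offSupport {D : FinDivisor} {p : Nat.Primes} :
    SpecZPt.prime p ∈ offSupport D ↔ D p = 0 :=
  ⟨fun h => h p rfl, fun h q hq => by cases hq; exact h⟩

theorem infty_mem_offSupport (D : FinDivisor) : SpecZPt.infty ∈ offSupport D :=
  fun _ h => by cases h

theorem generic_mem_offSupport (D : FinDivisor) : SpecZPt.generic ∈ offSupport D :=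
  fun _ h => by cases h

theorem ne_bot_of_mem {U : Opens SpecZBar} {x : SpecZPt} (h : x ∈ U) : U ≠ ⊥ := by
  rintro rfl
  exact h

/-- The rational number `r > 0` generates `O(D)` over the finite places of the nonempty open
set `W`. -/
structure IsGenerator (D : FinDivisor) (W : Opens SpecZBar) (r : ℚ) : Prop where
  ne_bot : W ≠ ⊥
  pos : 0 < r
  val : ∀ p : Nat.Primes, SpecZPt.prime p ∈ W → padicValRat p r + D p = 0

theorem IsGenerator.mem {D : FinDivisor} {W : Opens SpecZBar} {r : ℚ} (hr : IsGenerator D W r) :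
    r ∈ finSections D W :=
  ⟨fun p hp => Or.inr (hr.val p hp).ge, fun h => absurd h hr.ne_bot⟩

theorem IsGenerator.inv_mem {D : FinDivisor} {W : Opens SpecZBar} {r : ℚ}
    (hr : IsGenerator D W r) : r⁻¹ ∈ finSections (-D) W :=
  ⟨fun p hp => Or.inr (by
    have : Fact (p : ℕ).Prime := ⟨p.2⟩
    have := hr.val p hp
    rw [padicValRat.inv, Finsupp.neg_apply]
    lia), fun h => absurd h hr.ne_bot⟩

theorem IsGenerator.inv_mul_mem {D D' : FinDivisor} {W : Opens SpecZBar} {r q : ℚ}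
    (hr : IsGenerator D W r) (hq : q ∈ finSections (D + D') W) : r⁻¹ * q ∈ finSections D' W := by
  simpa only [neg_add_cancel_left] using finSections_mul hr.inv_mem hq

theorem isGenerator_inf_offSupport (D : FinDivisor) {U : Opens SpecZBar} (hU : U ≠ ⊥) {r : ℚ}
    (hr : 0 < r) :
    IsGenerator D (U ⊓ offSupport (principalFin (Units.mk0 r hr.ne') + D)) r where
  ne_bot := ne_bot_of_mem (x := SpecZPt.generic) ⟨generic_mem hU, generic_mem_offSupport _⟩
  pos := hr
  val _ hp := prime_mem_offSupport.1 hp.2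

theorem exists_isGenerator (D : FinDivisor) {U : Opens SpecZBar} {x : SpecZPt} (hx : x ∈ U)
    {s : ℚ} (hs : 0 < s) :
    ∃ W ≤ U, x ∈ W ∧ ∃ r, IsGenerator D W r ∧ (SpecZPt.infty ∈ W → r = s) := by
  cases x with
  | infty =>
    exact ⟨_, inf_le_left, ⟨hx, infty_mem_offSupport _⟩, s,
      isGenerator_inf_offSupport D (ne_bot_of_mem hx) hs, fun _ => rfl⟩
  | generic =>
    have h : SpecZPt.generic ∈ U ⊓ finitePart := ⟨hx, mem_finitePart.2 (by simp)⟩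
    exact ⟨_, inf_le_left.trans inf_le_left, ⟨h, generic_mem_offSupport _⟩, 1,
      isGenerator_inf_offSupport D (ne_bot_of_mem h) one_pos, fun h => absurd rfl h.1.2⟩
  | prime p =>
    have : Fact (p : ℕ).Prime := ⟨p.2⟩
    have h : SpecZPt.prime p ∈ U ⊓ finitePart := ⟨hx, mem_finitePart.2 (by simp)⟩
    have hr : (0 : ℚ) < (p : ℚ) ^ (-D p) := zpow_pos (by exact_mod_cast p.2.pos) _
    refine ⟨_, inf_le_left.trans inf_le_left, ⟨h, prime_mem_offSupport.2 ?_⟩, _,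
      isGenerator_inf_offSupport D (ne_bot_of_mem h) hr, fun h => absurd rfl h.1.2⟩
    change padicValRat p ((p : ℚ) ^ (-D p)) + D p = 0
    rw [padicValRat.zpow, padicValRat.self p.2.one_lt]
    ring

/-! ## The product of sections -/

/-- The sum `∑ |φ(i)|` as a rational number. -/
def sumAbsRat {k : GammaOp} (φ : Fin k.card → ℚ) : ℚ := ∑ i, |φ i|

theorem coe_sumAbsRat {k : GammaOp} (φ : Fin k.card → ℚ) : (sumAbsRat φ : ℝ) = sumAbs φ := by
  simp [sumAbsRat, sumAbs]

theorem sumAbsRat_nonneg {k : GammaOp} (φ : Fin k.card → ℚ) : 0 ≤ sumAbsRat φ :=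
  Finset.sum_nonneg fun _ _ => abs_nonneg _

theorem sumAbsRat_mul {k : GammaOp} (c : ℚ) (φ : Fin k.card → ℚ) :
    sumAbsRat (k := k) (fun i => c * φ i) = |c| * sumAbsRat φ := by
  simp only [sumAbsRat, abs_mul, Finset.mul_sum]

theorem NormSec.sumAbsRat_mem {D : FinDivisor} {B : LowerSet ℝ} {U : Opens SpecZBar} {k : GammaOp}
    (x : NormSec D B U k) (hU : SpecZPt.infty ∈ U) : (sumAbsRat x.val : ℝ) ∈ B := by
  rw [coe_sumAbsRat]
  exact x.bound hU

theorem normRes_val {D : FinDivisor} {B : LowerSet ℝ} {U V : Opens SpecZBar} (h : U ≤ V)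
    (hU : U ≠ ⊥) {k : GammaOp} (x : NormSec D B V k) : (normRes h x).val = x.val :=
  funext fun i => by
    change unitSec U * x.val i = x.val i
    rw [unitSec_of_ne hU, one_mul]

theorem prod_mul_left {m n k : GammaOp} (c : ℚ) (φ : Fin m.card → ℚ) (ψ : Fin n.card → ℚ)
    (v : SmashMap m n k) : prod (fun i => c * φ i) ψ v = fun l => c * prod φ ψ v l := by
  funext l
  simp only [prod, Finset.mul_sum, mul_ite, mul_zero, mul_assoc]

/-- The identification `1₊ ∧ k₊ ≃ k₊`. -/
def SmashMap.leftUnit (k : GammaOp) : SmashMap ⟨1⟩ k k where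
  toFun x y := x.bind fun _ => y
  left_none _ := rfl
  right_none x := by cases x <;> rfl

theorem prod_const_leftUnit (r : ℚ) {k : GammaOp} (ψ : Fin k.card → ℚ) :
    prod (m := ⟨1⟩) (fun _ => r) ψ (SmashMap.leftUnit k) = fun i => r * ψ i := by
  funext l
  simp [prod, SmashMap.leftUnit]

/-- On nonnegative rational numbers, the third bound consists of the products of elements of the
first two. -/
structure IsProductBound (B B' B'' : LowerSet ℝ) : Prop where
  mul : ∀ s t : ℚ, 0 ≤ s → 0 ≤ t → (s : ℝ) ∈ B → (t : ℝ) ∈ B' → ((s * t : ℚ) : ℝ) ∈ B''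
  split : ∀ t : ℚ, 0 ≤ t → (t : ℝ) ∈ B'' →
    ∃ r : ℚ, 0 < r ∧ (r : ℝ) ∈ B ∧ ((r⁻¹ * t : ℚ) : ℝ) ∈ B'

section Product

variable {D D' : FinDivisor} {B B' B'' : LowerSet ℝ}

/-- The product of a section of `‖H O(D)‖_B` and a section of `‖H O(D')‖_B'`. -/
def NormSec.mul (h : IsProductBound B B' B'') {U : Opens SpecZBar} {m n k : GammaOp}
    (x : NormSec D B U m) (y : NormSec D' B' U n) (v : SmashMap m n k) :
    NormSec (D + D') B'' U k where
  val := prod x.val y.val v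
  mem l := sum_mem fun i _ => sum_mem fun j _ => by
    split_ifs
    · exact finSections_mul (x.mem i) (y.mem j)
    · exact zero_mem _
  bound hU := by
    have hxy := h.mul _ _ (sumAbsRat_nonneg _) (sumAbsRat_nonneg _) (x.sumAbsRat_mem hU)
      (y.sumAbsRat_mem hU)
    rw [Rat.cast_mul, coe_sumAbsRat, coe_sumAbsRat] at hxy
    exact B''.lower (sumAbs_prod_le v x.val y.val) hxy

variable (hB : (0 : ℝ) ∈ B) (hB' : (0 : ℝ) ∈ B') (hB'' : (0 : ℝ) ∈ B'')

/-- The bilinear map `‖H O(D)‖_B × ‖H O(D')‖_B' → ‖H O(D + D')‖_B''` given by the product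
of `ℚ`. -/
def prodPairing (h : IsProductBound B B' B'') :
    PresheafOfSMod.Pairing (normPresheaf D B hB) (normPresheaf D' B' hB')
      (normPresheaf (D + D') B'' hB'') where
  toFun x y v := NormSec.mul h x y v
  map_map f g _ _ v := NormSec.ext (prod_push f g v _ _)
  map_post h _ _ v := NormSec.ext (push_prod v h _ _).symm
  balance a x y r w s w' h := NormSec.ext <|
    (congrArg (fun φ => prod φ (NormSec.val y) w) (prod_comm r _ _)).trans
      (prod_assoc r.swap w s w' (fun i c j => h c i j) (NormSec.val x) (NormSec.val a) _)
  act_act a x y r w s w' h :=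
    NormSec.ext (prod_assoc r w s w' h (NormSec.val a) (NormSec.val x) (NormSec.val y))
  res_res _ _ _ _ _ _ v := NormSec.ext (prod_mul _ (unitSec_mul_unitSec le_rfl) v _ _)

/-- A generator as a section. -/
def IsGenerator.sec {W : Opens SpecZBar} {r : ℚ} (hr : IsGenerator D W r)
    (hrB : SpecZPt.infty ∈ W → (r : ℝ) ∈ B) : NormSec D B W ⟨1⟩ where
  val _ := r
  mem _ := hr.mem
  bound hW := by
    have : |(r : ℝ)| = r := abs_of_pos (by exact_mod_cast hr.pos)
    simpa [sumAbs, this] using hrB hW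

/-- The quotient of a section by a generator. -/
def IsGenerator.quot {W : Opens SpecZBar} {r : ℚ} (hr : IsGenerator D W r) {D'' : FinDivisor}
    (hD : D'' = D + D') {k : GammaOp} (t : NormSec D'' B'' W k)
    (ht : SpecZPt.infty ∈ W → ((r⁻¹ * sumAbsRat t.val : ℚ) : ℝ) ∈ B') : NormSec D' B' W k where
  val i := r⁻¹ * t.val i
  mem i := hr.inv_mul_mem (hD ▸ t.mem i)
  bound hW := by
    rw [← coe_sumAbsRat, sumAbsRat_mul, abs_of_pos (inv_pos.2 hr.pos)]
    exact ht hW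

theorem IsGenerator.mul_inv_mul {W : Opens SpecZBar} {r : ℚ} (hr : IsGenerator D W r) (q : ℚ) :
    r * (r⁻¹ * q) = q :=
  mul_inv_cancel_left₀ hr.pos.ne' q

theorem IsGenerator.smashMk_eq {W : Opens SpecZBar} {r : ℚ} (hr : IsGenerator D W r)
    (hrB : SpecZPt.infty ∈ W → (r : ℝ) ∈ B) {m n k : GammaOp} (x : NormSec D B W m)
    (hx : SpecZPt.infty ∈ W → ((r⁻¹ * sumAbsRat x.val : ℚ) : ℝ) ∈ LowerSet.Iic (1 : ℝ))
    (y : NormSec D' B' W n) (v : SmashMap m n k) :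
    smashMk (M := (normPresheaf D B hB).obj W) (N := (normPresheaf D' B' hB').obj W) x y v =
      smashMk (M := (normPresheaf D B hB).obj W) (N := (normPresheaf D' B' hB').obj W)
        (hr.sec hrB : NormSec D B W ⟨1⟩) (normMul (hr.quot (add_zero D).symm x hx) y v)
        (SmashMap.leftUnit k) := by
  have hxa : x = normMul (hr.quot (add_zero D).symm x hx) (hr.sec hrB : NormSec D B W ⟨1⟩)
      (SmashMap.leftUnit m).swap := by
    refine NormSec.ext (Eq.trans ?_ (prod_comm (SmashMap.leftUnit m) (fun _ => r) _))
    rw [prod_const_leftUnit]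
    exact funext fun i => (hr.mul_inv_mul _).symm
  nth_rw 1 [hxa]
  exact Quot.sound (SmashRel.balance (M := (normPresheaf D B hB).obj W)
    (N := (normPresheaf D' B' hB').obj W) (hr.quot (add_zero D).symm x hx)
    (hr.sec hrB : NormSec D B W ⟨1⟩) y (SmashMap.leftUnit m).swap v v (SmashMap.leftUnit k)
    fun c i j => by
      cases i with
      | none => exact v.left_none j
      | some i => rfl)

theorem IsGenerator.smashMk_eq_smashMk {W : Opens SpecZBar} {r : ℚ} (hr : IsGenerator D W r)
    (hrB : SpecZPt.infty ∈ W → (r : ℝ) ∈ B) {m₁ n₁ m₂ n₂ k : GammaOp}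
    {x₁ : NormSec D B W m₁} (hx₁ : SpecZPt.infty ∈ W → sumAbsRat x₁.val ≤ r)
    {x₂ : NormSec D B W m₂} (hx₂ : SpecZPt.infty ∈ W → sumAbsRat x₂.val ≤ r)
    {y₁ : NormSec D' B' W n₁} {y₂ : NormSec D' B' W n₂} {v₁ : SmashMap m₁ n₁ k}
    {v₂ : SmashMap m₂ n₂ k} (h : prod x₁.val y₁.val v₁ = prod x₂.val y₂.val v₂) :
    smashMk (M := (normPresheaf D B hB).obj W) (N := (normPresheaf D' B' hB').obj W) x₁ y₁ v₁ =
      smashMk (M := (normPresheaf D B hB).obj W) (N := (normPresheaf D' B' hB').obj W)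
        x₂ y₂ v₂ := by
  have quot_le : ∀ s : ℚ, s ≤ r → ((r⁻¹ * s : ℚ) : ℝ) ∈ LowerSet.Iic (1 : ℝ) := fun s hs => by
    rw [LowerSet.mem_Iic_iff]
    exact_mod_cast (inv_mul_le_one₀ hr.pos).2 hs
  rw [hr.smashMk_eq hB hB' hrB x₁ (fun hW => quot_le _ (hx₁ hW)),
    hr.smashMk_eq hB hB' hrB x₂ (fun hW => quot_le _ (hx₂ hW))]
  congr 1
  refine NormSec.ext ?_
  change prod (fun i => r⁻¹ * x₁.val i) y₁.val v₁ = prod (fun i => r⁻¹ * x₂.val i) y₂.val v₂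
  rw [prod_mul_left, prod_mul_left, h]

theorem NormSec.exists_common_bound {U : Opens SpecZBar} {s : ℚ} (hs : 0 < s)
    (hsB : SpecZPt.infty ∈ U → (s : ℝ) ∈ B) {m n : GammaOp} (x : NormSec D B U m)
    (y : NormSec D' B U n) : ∃ r : ℚ, 0 < r ∧
      (SpecZPt.infty ∈ U → (r : ℝ) ∈ B ∧ sumAbsRat x.val ≤ r ∧ sumAbsRat y.val ≤ r) :=
  ⟨max s (max (sumAbsRat x.val) (sumAbsRat y.val)), lt_max_of_lt_left hs, fun hU =>
    ⟨max_rec' (fun q : ℚ => (q : ℝ) ∈ B) (hsB hU)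
      (max_rec' (fun q : ℚ => (q : ℝ) ∈ B) (x.sumAbsRat_mem hU) (y.sumAbsRat_mem hU)),
      by simp, by simp⟩⟩

theorem prodPairing_locallyInjective (h : IsProductBound B B' B'') :
    PresheafOfSMod.LocallyInjective
      (prodPairing (D := D) (D' := D') hB hB' hB'' h).lift := by
  rintro U k ⟨x₁, y₁, v₁⟩ ⟨x₂, y₂, v₂⟩ hprod q hq
  change NormSec D B U _ at x₁ x₂
  change NormSec D' B' U _ at y₁ y₂
  have hval : prod x₁.val y₁.val v₁ = prod x₂.val y₂.val v₂ := congrArg NormSec.val hprod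
  obtain ⟨r₀, hr₀, hr₀B, -⟩ := h.split 0 le_rfl (by simpa using hB'')
  obtain ⟨s, hs, hsU⟩ := NormSec.exists_common_bound hr₀ (fun _ => hr₀B) x₁ x₂
  obtain ⟨W, hW, hqW, r, hr, hrs⟩ := exists_isGenerator D hq hs
  refine ⟨W, hW, hqW, hr.smashMk_eq_smashMk hB hB' (x₁ := normRes hW x₁) (x₂ := normRes hW x₂)
    (y₁ := normRes hW y₁) (y₂ := normRes hW y₂) (fun hi => ?_) (fun hi => ?_) (fun hi => ?_) ?_⟩
  · exact hrs hi ▸ (hsU (hW hi)).1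
  · rw [normRes_val hW hr.ne_bot, hrs hi]
    exact (hsU (hW hi)).2.1
  · rw [normRes_val hW hr.ne_bot, hrs hi]
    exact (hsU (hW hi)).2.2
  · simpa only [normRes_val hW hr.ne_bot] using hval

theorem prodPairing_locallySurjective (h : IsProductBound B B' B'') :
    PresheafOfSMod.LocallySurjective
      (prodPairing (D := D) (D' := D') hB hB' hB'' h).lift := by
  intro U k (t : NormSec (D + D') B'' U k) q hq
  obtain ⟨s, hs, hsU⟩ : ∃ s : ℚ, 0 < s ∧ (SpecZPt.infty ∈ U → (s : ℝ) ∈ B ∧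
      ((s⁻¹ * sumAbsRat t.val : ℚ) : ℝ) ∈ B') := by
    by_cases hU : SpecZPt.infty ∈ U
    · obtain ⟨s, hs, hsB, hsB'⟩ := h.split _ (sumAbsRat_nonneg t.val) (t.sumAbsRat_mem hU)
      exact ⟨s, hs, fun _ => ⟨hsB, hsB'⟩⟩
    · exact ⟨1, one_pos, fun hU' => absurd hU' hU⟩
  obtain ⟨W, hW, hqW, r, hr, hrs⟩ := exists_isGenerator D hq hs
  let x : NormSec D B W ⟨1⟩ := hr.sec fun hi => hrs hi ▸ (hsU (hW hi)).1
  let y : NormSec D' B' W k := hr.quot rfl (normRes hW t) fun hi => by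
    rw [normRes_val hW hr.ne_bot, hrs hi]
    exact (hsU (hW hi)).2
  refine ⟨W, hW, hqW, smashMk (M := (normPresheaf D B hB).obj W)
    (N := (normPresheaf D' B' hB').obj W) x y (SmashMap.leftUnit k), NormSec.ext ?_⟩
  exact (prod_const_leftUnit r y.val).trans (funext fun i => hr.mul_inv_mul _)

/-- The isomorphism induced by the product of `ℚ` from the smash product to the sheaf with the
product bound. -/
noncomputable def smashIso (D D' : FinDivisor) (h : IsProductBound B B' B'') :
    SheafOfSMod.smash (normSheaf D B hB) (normSheaf D' B' hB') ≅ normSheaf (D + D') B'' hB'' :=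
  PresheafOfSMod.sheafifyIso _ (prodPairing_locallyInjective hB hB' hB'' h)
    (prodPairing_locallySurjective hB hB' hB'' h) (normPresheaf_isSheaf (D + D') B'' hB'')

theorem smashIso_smashSec (h : IsProductBound B B' B'') {U : Opens SpecZBar} {m n k : GammaOp}
    (x : NormSec D B U m) (y : NormSec D' B' U n) (v : SmashMap m n k) :
    evalAt (PresheafOfSMod.Hom.app (smashIso hB hB' hB'' D D' h).hom.hom U)
      (SheafOfSMod.smashSec (M := normSheaf D B hB) (N := normSheaf D' B' hB') x y v) =
        NormSec.mul h x y v :=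
  PresheafOfSMod.sheafifyIso_toSh _ (prodPairing_locallyInjective hB hB' hB'' h)
    (prodPairing_locallySurjective hB hB' hB'' h) (normPresheaf_isSheaf (D + D') B'' hB'')
    (smashMk (M := (normPresheaf D B hB).obj U) (N := (normPresheaf D' B' hB').obj U) x y v :
      (((normPresheaf D B hB).smash (normPresheaf D' B' hB')).obj U).obj k)

end Product

/-! ## Morphisms are multiplications by rational numbers -/

/-- The projection `k₊ → 1₊` to the `i`-th coordinate. -/
def coordMap {k : GammaOp} (i : Fin k.card) : k ⟶ (⟨1⟩ : GammaOp) :=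
  ⟨fun y => if y = some i then some 0 else none, by simp⟩

theorem push_coordMap {k : GammaOp} (i : Fin k.card) (φ : Fin k.card → ℚ) :
    push (coordMap i) φ = fun _ => φ i := by
  have coordMap_eq_iff : ∀ l, (coordMap i).toFun (some l) = some 0 ↔ l = i := by simp [coordMap]
  funext j
  obtain rfl : j = 0 := Subsingleton.elim (α := Fin 1) _ _
  simp [push, coordMap_eq_iff]

/-- The integer `z` as a section of the structure sheaf. The norm bound `1` allows it only away from
`∞`. -/
def intSec (z : ℤ) {U : Opens SpecZBar} (hU : U ≠ ⊥) (hi : SpecZPt.infty ∉ U) :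
    NormSec 0 (LowerSet.Iic 1) U ⟨1⟩ where
  val _ := z
  mem _ := ⟨fun p _ => Or.inr (by simp), fun h => absurd h hU⟩
  bound h := absurd h hi

theorem normMul_intSec_val {D : FinDivisor} {B : LowerSet ℝ} (z : ℤ) {U : Opens SpecZBar}
    (hU : U ≠ ⊥) (hi : SpecZPt.infty ∉ U) {k : GammaOp} (x : NormSec D B U k) :
    (normMul (intSec z hU hi) x (SmashMap.leftUnit k)).val = fun i => z * x.val i :=
  prod_const_leftUnit _ _

theorem exists_one_sec (D : FinDivisor) (B : LowerSet ℝ) :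
    ∃ V : Opens SpecZBar, V ≠ ⊥ ∧ SpecZPt.infty ∉ V ∧
      ∃ o : NormSec D B V ⟨1⟩, o.val = fun _ => 1 := by
  have hV := isGenerator_inf_offSupport D
    (ne_bot_of_mem (mem_finitePart.2 (by simp) : SpecZPt.generic ∈ finitePart)) one_pos
  have hi : SpecZPt.infty ∉ finitePart ⊓ offSupport (principalFin (Units.mk0 1 one_ne_zero) + D) :=
    fun h => h.1 rfl
  exact ⟨_, hV.ne_bot, hi, hV.sec fun h => absurd h hi, rfl⟩

section Scalar

variable {D D' D'' : FinDivisor} {B B' B'' : LowerSet ℝ} {hB : (0 : ℝ) ∈ B} {hB' : (0 : ℝ) ∈ B'}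
  {hB'' : (0 : ℝ) ∈ B''}

/-- The action of a morphism of presheaves on sections. -/
noncomputable def NormSec.map (f : normPresheaf D B hB ⟶ normPresheaf D' B' hB')
    {U : Opens SpecZBar} {k : GammaOp} (x : NormSec D B U k) : NormSec D' B' U k :=
  evalAt (PresheafOfSMod.Hom.app f U) (x : ((normPresheaf D B hB).obj U).obj k)

theorem NormSec.map_normRes (f : normPresheaf D B hB ⟶ normPresheaf D' B' hB')
    {U V : Opens SpecZBar} (h : U ≤ V) {k : GammaOp} (x : NormSec D B V k) :
    (normRes h x).map f = normRes h (x.map f) :=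
  PresheafOfSMod.Hom.app_res_apply f h (x : ((normPresheaf D B hB).obj V).obj k)

theorem NormSec.map_normMul (f : normPresheaf D B hB ⟶ normPresheaf D' B' hB')
    {U : Opens SpecZBar} {m n k : GammaOp} (a : NormSec 0 (LowerSet.Iic 1) U m)
    (x : NormSec D B U n) (v : SmashMap m n k) :
    (normMul a x v).map f = normMul a (x.map f) v :=
  PresheafOfSMod.Hom.app_act f U v a x

/-- The `i`-th coordinate of a section. -/
def NormSec.coord (hB : (0 : ℝ) ∈ B) {U : Opens SpecZBar} {k : GammaOp} (x : NormSec D B U k)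
    (i : Fin k.card) : NormSec D B U ⟨1⟩ :=
  (normGamma D B hB U).mp (coordMap i) x

theorem NormSec.coord_val {U : Opens SpecZBar} {k : GammaOp} (x : NormSec D B U k)
    (i : Fin k.card) : (x.coord hB i).val = fun _ => x.val i :=
  push_coordMap i x.val

theorem NormSec.coord_map (f : normPresheaf D B hB ⟶ normPresheaf D' B' hB')
    {U : Opens SpecZBar} {k : GammaOp} (x : NormSec D B U k) (i : Fin k.card) :
    (x.coord hB i).map f = (x.map f).coord hB' i :=
  evalAt_map (PresheafOfSMod.Hom.app f U) (coordMap i)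
    (x : ((normPresheaf D B hB).obj U).obj k)

theorem NormSec.map_val_of_mul_val_eq (f : normPresheaf D B hB ⟶ normPresheaf D' B' hB')
    {U V W : Opens SpecZBar} (hU : W ≤ U) (hV : W ≤ V) (hW : W ≠ ⊥) (hi : SpecZPt.infty ∉ W)
    {k : GammaOp} {x : NormSec D B U k} {y : NormSec D B V k} {z w : ℤ}
    (h : (fun i => z * x.val i) = fun i => w * y.val i) :
    (fun i => z * (x.map f).val i) = fun i => w * (y.map f).val i := by
  have hxy : normMul (intSec z hW hi) (normRes hU x) (SmashMap.leftUnit k) =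
      normMul (intSec w hW hi) (normRes hV y) (SmashMap.leftUnit k) := NormSec.ext (by
    rw [normMul_intSec_val, normMul_intSec_val, normRes_val hU hW, normRes_val hV hW, h])
  have hval := congrArg (fun s => (s.map f).val) hxy
  simpa only [map_normMul, map_normRes, normMul_intSec_val, normRes_val _ hW] using hval

/-- The morphism `f` multiplies sections by `c`. -/
def IsMulBy (f : normPresheaf D B hB ⟶ normPresheaf D' B' hB') (c : ℚ) : Prop :=
  ∀ ⦃U : Opens SpecZBar⦄ ⦃k : GammaOp⦄ (x : NormSec D B U k) (i : Fin k.card),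
    (x.map f).val i = c * x.val i

/-- The sections of `O(D)` over a nonempty open set are commensurable away from `∞`, where the
integers act. -/
theorem exists_isMulBy (f : normPresheaf D B hB ⟶ normPresheaf D' B' hB') :
    ∃ c : ℚ, IsMulBy f c := by
  obtain ⟨V, hV, hi, o, ho⟩ := exists_one_sec D B
  have level_one : ∀ {U : Opens SpecZBar} (x : NormSec D B U ⟨1⟩),
      (x.map f).val 0 = (o.map f).val 0 * x.val 0 := by
    intro U x
    by_cases hU : U = ⊥
    · rw [(x.mem 0).2 hU, ((x.map f).mem 0).2 hU, mul_zero]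
    have hUV : U ⊓ V ≠ ⊥ :=
      ne_bot_of_mem (x := SpecZPt.generic) ⟨generic_mem hU, generic_mem hV⟩
    have den_mul : ((x.val 0).den : ℚ) * (x.map f).val 0 = (x.val 0).num * (o.map f).val 0 := by
      refine congrFun (NormSec.map_val_of_mul_val_eq f (inf_le_left : U ⊓ V ≤ U) inf_le_right hUV
        (fun h => hi h.2) (x := x) (y := o) (z := (x.val 0).den) (w := (x.val 0).num) ?_) 0
      funext i
      obtain rfl : i = 0 := Subsingleton.elim (α := Fin 1) _ _
      rw [ho, mul_one, Int.cast_natCast, Rat.den_mul_eq_num]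
    have hden : ((x.val 0).den : ℚ) ≠ 0 := by exact_mod_cast (x.val 0).den_nz
    apply mul_left_cancel₀ hden
    rw [den_mul, ← Rat.den_mul_eq_num]
    ring
  refine ⟨(o.map f).val 0, fun _ _ x i => ?_⟩
  have h := level_one (x.coord hB i)
  rwa [NormSec.coord_map, NormSec.coord_val, NormSec.coord_val] at h

theorem IsMulBy.unique {f : normPresheaf D B hB ⟶ normPresheaf D' B' hB'} {c c' : ℚ}
    (h : IsMulBy f c) (h' : IsMulBy f c') : c = c' := by
  obtain ⟨V, -, -, o, ho⟩ := exists_one_sec D B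
  simpa only [ho, mul_one] using (h o 0).symm.trans (h' o 0)

theorem isMulBy_id : IsMulBy (𝟙 (normPresheaf D B hB)) 1 :=
  fun _ _ x i => (one_mul (x.val i)).symm

theorem IsMulBy.comp {f : normPresheaf D B hB ⟶ normPresheaf D' B' hB'}
    {g : normPresheaf D' B' hB' ⟶ normPresheaf D'' B'' hB''} {c c' : ℚ} (hf : IsMulBy f c)
    (hg : IsMulBy g c') : IsMulBy (f ≫ g) (c' * c) := fun _ _ x i => by
  rw [mul_assoc, ← hf x i]
  exact hg (x.map f) i

theorem IsMulBy.hom_ext {f g : normPresheaf D B hB ⟶ normPresheaf D' B' hB'} {c : ℚ}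
    (hf : IsMulBy f c) (hg : IsMulBy g c) : f = g :=
  PresheafOfSMod.hom_ext_apply fun _ _ x =>
    NormSec.ext (funext fun i => (hf x i).trans (hg x i).symm)

/-- The multiplication by `c` maps `‖H O(D)‖_B` to `‖H O(D')‖_B'`. -/
structure IsMultiplier (D : FinDivisor) (B : LowerSet ℝ) (D' : FinDivisor) (B' : LowerSet ℝ)
    (c : ℚˣ) : Prop where
  le : ∀ p, D p ≤ D' p + principalFin c p
  mem : ∀ r : ℚ, 0 < r → (r : ℝ) ∈ B → ((|(c : ℚ)| * r : ℚ) : ℝ) ∈ B'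

theorem IsMulBy.isMultiplier {f : normPresheaf D B hB ⟶ normPresheaf D' B' hB'} {c : ℚˣ}
    (hf : IsMulBy f c) : IsMultiplier D B D' B' c where
  le p := by
    have : Fact (p : ℕ).Prime := ⟨p.2⟩
    obtain ⟨W, hW, hp, r, hr, -⟩ := exists_isGenerator D
      (mem_finitePart.2 (by simp) : SpecZPt.prime p ∈ finitePart) one_pos
    let s : NormSec D B W ⟨1⟩ := hr.sec fun hi => absurd rfl (hW hi)
    have hcr : (c : ℚ) * r ∈ finSections D' W := hf s 0 ▸ (s.map f).mem 0
    have h := (hcr.1 p hp).resolve_left (mul_ne_zero c.ne_zero hr.pos.ne')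
    rw [padicValRat.mul c.ne_zero hr.pos.ne'] at h
    have := hr.val p hp
    change D p ≤ D' p + padicValRat p c
    lia
  mem r hr hrB := by
    obtain ⟨W, -, hi, s, hs, hsr⟩ := exists_isGenerator D
      (Opens.mem_top (α := SpecZBar) SpecZPt.infty) hr
    obtain rfl := hsr hi
    have h := ((hs.sec fun _ => hrB : NormSec D B W ⟨1⟩).map f).sumAbsRat_mem hi
    rw [funext (hf _), sumAbsRat_mul] at h
    simpa [sumAbsRat, IsGenerator.sec, abs_of_pos hr] using h

theorem IsMultiplier.mul_mem_finSections {c : ℚˣ} (hc : IsMultiplier D B D' B' c)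
    {U : Opens SpecZBar} {q : ℚ} (hq : q ∈ finSections D U) : c * q ∈ finSections D' U := by
  by_cases hU : U = ⊥
  · rw [hq.2 hU, mul_zero]
    exact zero_mem _
  have hcU : (c : ℚ) ∈ finSections (D' - D) U := ⟨fun p _ => Or.inr (by
    have := hc.le p
    change D p ≤ D' p + padicValRat p c at this
    rw [Finsupp.sub_apply]
    lia), fun h => absurd h hU⟩
  simpa only [sub_add_cancel] using finSections_mul hcU hq

theorem IsMultiplier.sumAbs_mem {c : ℚˣ} (hc : IsMultiplier D B D' B' c) (hB' : (0 : ℝ) ∈ B')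
    {k : GammaOp} {φ : Fin k.card → ℚ} (hφ : (sumAbsRat φ : ℝ) ∈ B) :
    sumAbs (n := k) (fun i => (c : ℚ) * φ i) ∈ B' := by
  rw [← coe_sumAbsRat, sumAbsRat_mul]
  rcases (sumAbsRat_nonneg φ).eq_or_lt with h | h
  · rwa [← h, mul_zero, Rat.cast_zero]
  · exact hc.mem _ h hφ

/-- The multiplication by `c` as a morphism. -/
noncomputable def IsMultiplier.hom {c : ℚˣ} (hc : IsMultiplier D B D' B' c) (hB : (0 : ℝ) ∈ B)
    (hB' : (0 : ℝ) ∈ B') : normPresheaf D B hB ⟶ normPresheaf D' B' hB' :=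
  PresheafOfSMod.homMk
    (fun U k (x : NormSec D B U k) => (⟨fun i => c * x.val i,
      fun i => hc.mul_mem_finSections (x.mem i),
      fun hU => hc.sumAbs_mem hB' (x.sumAbsRat_mem hU)⟩ : NormSec D' B' U k))
    (fun _ _ _ g _ => NormSec.ext (push_mul _ g _).symm)
    (fun _ _ _ => NormSec.ext (funext fun _ => mul_left_comm _ _ _))
    (fun _ _ _ _ v a x => NormSec.ext (by
      change (fun l => (c : ℚ) * prod (NormSec.val a) (NormSec.val x) v l) =
        prod (NormSec.val a) (fun i => c * NormSec.val x i) v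
      rw [prod_comm v, prod_comm v, prod_mul_left]))

theorem IsMultiplier.isMulBy_hom {c : ℚˣ} (hc : IsMultiplier D B D' B' c) (hB : (0 : ℝ) ∈ B)
    (hB' : (0 : ℝ) ∈ B') : IsMulBy (hc.hom hB hB') c :=
  fun _ _ _ _ => rfl

theorem nonempty_normSheaf_iso_iff_isMultiplier :
    Nonempty (normSheaf D B hB ≅ normSheaf D' B' hB') ↔
      ∃ c : ℚˣ, IsMultiplier D B D' B' c ∧ IsMultiplier D' B' D B c⁻¹ := by
  constructor
  · rintro ⟨e⟩
    let f : normPresheaf D B hB ⟶ normPresheaf D' B' hB' := e.hom.hom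
    let g : normPresheaf D' B' hB' ⟶ normPresheaf D B hB := e.inv.hom
    have hfg : f ≫ g = 𝟙 _ := congrArg InducedCategory.Hom.hom e.hom_inv_id
    obtain ⟨c, hc⟩ := exists_isMulBy f
    obtain ⟨c', hc'⟩ := exists_isMulBy g
    have inv_mul : c' * c = 1 := (hc.comp hc').unique (hfg ▸ isMulBy_id)
    let u : ℚˣ := ⟨c, c', by rw [mul_comm, inv_mul], inv_mul⟩
    exact ⟨u, IsMulBy.isMultiplier (c := u) hc, IsMulBy.isMultiplier (c := u⁻¹) hc'⟩
  · rintro ⟨c, hc, hc'⟩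
    exact ⟨ObjectProperty.isoMk _
      { hom := hc.hom hB hB'
        inv := hc'.hom hB' hB
        hom_inv_id := ((hc.isMulBy_hom hB hB').comp (hc'.isMulBy_hom hB' hB)).hom_ext
          (by rw [Units.inv_mul]; exact isMulBy_id)
        inv_hom_id := ((hc'.isMulBy_hom hB' hB).comp (hc.isMulBy_hom hB hB')).hom_ext
          (by rw [Units.mul_inv]; exact isMulBy_id) }⟩

theorem principalFin_inv (c : ℚˣ) : principalFin c⁻¹ = -principalFin c := Finsupp.ext fun p => by
  have : Fact (p : ℕ).Prime := ⟨p.2⟩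
  change padicValRat p ((c⁻¹ : ℚˣ) : ℚ) = -padicValRat p c
  rw [Units.val_inv_eq_inv_val, padicValRat.inv]

theorem isMultiplier_and_inv_iff {c : ℚˣ} :
    IsMultiplier D B D' B' c ∧ IsMultiplier D' B' D B c⁻¹ ↔
      D = D' + principalFin c ∧
        ∀ r : ℚ, 0 < r → ((r : ℝ) ∈ B ↔ ((|(c : ℚ)| * r : ℚ) : ℝ) ∈ B') := by
  have abs_pos : 0 < |(c : ℚ)| := abs_pos.2 c.ne_zero
  constructor
  · rintro ⟨h, h'⟩
    refine ⟨Finsupp.ext fun p => (h.le p).antisymm ?_, fun r hr => ⟨h.mem r hr, fun hrB => ?_⟩⟩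
    · have := h'.le p
      rw [principalFin_inv, Finsupp.neg_apply] at this
      change D' p + principalFin c p ≤ D p
      lia
    · have := h'.mem _ (mul_pos abs_pos hr) hrB
      rwa [Units.val_inv_eq_inv_val, abs_inv, inv_mul_cancel_left₀ abs_pos.ne'] at this
  · rintro ⟨rfl, h⟩
    refine ⟨⟨fun p => le_rfl, fun r hr => (h r hr).1⟩, ⟨fun p => ?_, fun r hr hrB => ?_⟩⟩
    · rw [principalFin_inv, Finsupp.add_apply, Finsupp.neg_apply, add_neg_cancel_right]
    · rw [Units.val_inv_eq_inv_val, abs_inv, h _ (mul_pos (inv_pos.2 abs_pos) hr),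
        mul_inv_cancel_left₀ abs_pos.ne']
      exact hrB

theorem nonempty_normSheaf_iso_iff : Nonempty (normSheaf D B hB ≅ normSheaf D' B' hB') ↔
    ∃ c : ℚˣ, D = D' + principalFin c ∧
      ∀ r : ℚ, 0 < r → ((r : ℝ) ∈ B ↔ ((|(c : ℚ)| * r : ℚ) : ℝ) ∈ B') := by
  simp only [nonempty_normSheaf_iso_iff_isMultiplier, isMultiplier_and_inv_iff]

end Scalar

/-! ## Norm bounds -/

theorem exists_rat_split {l m : ℝ} (hm : 0 < m) {t : ℚ} (ht : 0 ≤ t) (h : (t : ℝ) < l * m) :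
    ∃ r : ℚ, 0 < r ∧ (r : ℝ) < l ∧ ((r⁻¹ * t : ℚ) : ℝ) < m := by
  have ht' : (0 : ℝ) ≤ t := by exact_mod_cast ht
  obtain ⟨r, h1, h2⟩ := exists_rat_btwn ((div_lt_iff₀ hm).2 h)
  have hr : (0 : ℝ) < r := (div_nonneg ht' hm.le).trans_lt h1
  refine ⟨r, by exact_mod_cast hr, h2, ?_⟩
  rw [Rat.cast_mul, Rat.cast_inv, inv_mul_lt_iff₀ hr]
  exact (div_lt_iff₀ hm).1 h1

theorem isProductBound_Iio {B B' : LowerSet ℝ} {l m : ℝ} (hm : 0 < m)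
    (hB : LowerSet.Iio l ≤ B) (hB' : LowerSet.Iio m ≤ B')
    (h : ∀ s t : ℚ, 0 ≤ s → 0 ≤ t → (s : ℝ) ∈ B → (t : ℝ) ∈ B' → (s : ℝ) * t < l * m) :
    IsProductBound B B' (LowerSet.Iio (l * m)) where
  mul s t hs ht hsB htB := by
    rw [LowerSet.mem_Iio_iff, Rat.cast_mul]
    exact h s t hs ht hsB htB
  split t ht htB := by
    obtain ⟨r, hr, hrl, hrm⟩ := exists_rat_split hm ht (LowerSet.mem_Iio_iff.1 htB)
    exact ⟨r, hr, hB (LowerSet.mem_Iio_iff.2 hrl), hB' (LowerSet.mem_Iio_iff.2 hrm)⟩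

theorem lowerSet_Iio_le_Iic (l : ℝ) : LowerSet.Iio l ≤ LowerSet.Iic l :=
  fun _ h => LowerSet.mem_Iic_iff.2 (LowerSet.mem_Iio_iff.1 h).le

theorem isProductBound_Iio_Iic {l m : ℝ} (hm : 0 < m) :
    IsProductBound (LowerSet.Iio l) (LowerSet.Iic m) (LowerSet.Iio (l * m)) :=
  isProductBound_Iio hm le_rfl (lowerSet_Iio_le_Iic m) fun _ _ hs _ hsl htm =>
    mul_lt_mul_of_lt_of_le_of_nonneg_of_pos hsl htm (by exact_mod_cast hs) hm

theorem isProductBound_Iic_Iio {l m : ℝ} (hl : 0 < l) (hm : 0 < m) :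
    IsProductBound (LowerSet.Iic l) (LowerSet.Iio m) (LowerSet.Iio (l * m)) :=
  isProductBound_Iio hm (lowerSet_Iio_le_Iic l) le_rfl fun _ _ _ ht hsl htm =>
    mul_lt_mul_of_le_of_lt_of_nonneg_of_pos hsl htm (by exact_mod_cast ht) hl

theorem isProductBound_Iic_of_irrational {l m : ℝ} (hm : 0 < m) (hl : Irrational l) :
    IsProductBound (LowerSet.Iic l) (LowerSet.Iic m) (LowerSet.Iio (l * m)) :=
  isProductBound_Iio hm (lowerSet_Iio_le_Iic l) (lowerSet_Iio_le_Iic m) fun s _ hs _ hsl htm =>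
    mul_lt_mul_of_lt_of_le_of_nonneg_of_pos
      ((LowerSet.mem_Iic_iff.1 hsl).lt_of_ne (hl.ne_rat s).symm) htm (by exact_mod_cast hs) hm

theorem isProductBound_Iic {l m : ℝ} (hl : 0 < l) (hm : 0 < m)
    (h : ¬ (Irrational l ∧ Irrational m ∧ ¬ Irrational (l * m))) :
    IsProductBound (LowerSet.Iic l) (LowerSet.Iic m) (LowerSet.Iic (l * m)) where
  mul s t _ ht hsl htm := by
    rw [LowerSet.mem_Iic_iff, Rat.cast_mul]
    exact mul_le_mul hsl htm (by exact_mod_cast ht) hl.le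
  split t ht htB := by
    rcases (LowerSet.mem_Iic_iff.1 htB).lt_or_eq with hlt | heq
    · obtain ⟨r, hr, hrl, hrm⟩ := exists_rat_split hm ht hlt
      exact ⟨r, hr, LowerSet.mem_Iic_iff.2 hrl.le, LowerSet.mem_Iic_iff.2 hrm.le⟩
    · have not_irrational : ¬ Irrational l := fun hi => h ⟨hi, by
        rintro ⟨q, rfl⟩
        exact hi ⟨t / q, by rw [Rat.cast_div, heq, mul_div_cancel_right₀ _ hm.ne']⟩,
        fun hlm => hlm ⟨t, heq⟩⟩
      obtain ⟨r, rfl⟩ := not_not.1 not_irrational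
      refine ⟨r, by exact_mod_cast hl, LowerSet.mem_Iic_iff.2 le_rfl, LowerSet.mem_Iic_iff.2 ?_⟩
      rw [Rat.cast_mul, heq, Rat.cast_inv, inv_mul_cancel_left₀ hl.ne']

theorem isEmpty_normSheaf_iso_Iio_Iic (D D' : FinDivisor) {l m : ℝ} (h0 : (0 : ℝ) ∈ LowerSet.Iio l)
    (h0' : (0 : ℝ) ∈ LowerSet.Iic m) (hl : ¬ Irrational l) :
    IsEmpty (normSheaf D (LowerSet.Iio l) h0 ≅ normSheaf D' (LowerSet.Iic m) h0') := by
  obtain ⟨l, rfl⟩ := not_not.1 hl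
  rw [← not_nonempty_iff, nonempty_normSheaf_iso_iff]
  rintro ⟨c, -, hc⟩
  simp only [LowerSet.mem_Iio_iff, LowerSet.mem_Iic_iff, Rat.cast_lt, Rat.cast_mul] at hc h0 h0'
  have abs_pos : (0 : ℝ) < (|(c : ℚ)| : ℚ) := by exact_mod_cast abs_pos.2 c.ne_zero
  have lt_mul : m < (|(c : ℚ)| : ℚ) * (l : ℝ) :=
    not_le.1 fun h => lt_irrefl l ((hc l (by exact_mod_cast h0)).2 h)
  obtain ⟨r, hmr, hrl⟩ := exists_rat_btwn ((div_lt_iff₀' abs_pos).2 lt_mul)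
  have hr : 0 < r := by exact_mod_cast (div_nonneg h0' abs_pos.le).trans_lt hmr
  exact ((hc r hr).1 (by exact_mod_cast hrl)).not_gt ((div_lt_iff₀' abs_pos).1 hmr)

theorem eq_of_forall_rat_le_iff {l m : ℝ} (hl : 0 < l) (hm : 0 < m)
    (h : ∀ r : ℚ, 0 < r → ((r : ℝ) ≤ l ↔ (r : ℝ) ≤ m)) : l = m := by
  have le_of_imp : ∀ {l m : ℝ}, 0 < m → (∀ r : ℚ, 0 < r → (r : ℝ) ≤ l → (r : ℝ) ≤ m) → l ≤ m := by
    intro l m hm h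
    by_contra! hml
    obtain ⟨r, hmr, hrl⟩ := exists_rat_btwn hml
    exact (h r (by exact_mod_cast hm.trans hmr) hrl.le).not_gt hmr
  exact (le_of_imp hm fun r hr => (h r hr).1).antisymm (le_of_imp hl fun r hr => (h r hr).2)

theorem forall_rat_mem_Iic_iff_mul_mem_Iic {l m : ℝ} (hl : 0 < l) (hm : 0 < m) {c : ℚˣ} :
    (∀ r : ℚ, 0 < r → ((r : ℝ) ∈ LowerSet.Iic l ↔ ((|(c : ℚ)| * r : ℚ) : ℝ) ∈ LowerSet.Iic m)) ↔
      |((c : ℚ) : ℝ)| * l = m := by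
  have hc : 0 < |((c : ℚ) : ℝ)| := abs_pos.2 (by exact_mod_cast c.ne_zero)
  simp only [LowerSet.mem_Iic_iff, Rat.cast_mul, Rat.cast_abs, ← le_div_iff₀' hc]
  rw [mul_comm, ← eq_div_iff hc.ne']
  exact ⟨eq_of_forall_rat_le_iff hl (div_pos hm hc), fun h r _ => by rw [h]⟩

/-! ## The sheaves `O(D)` -/

theorem sub_eq_principal_inv_iff {D D' : ArakelovDivisor} {c : ℚˣ} :
    D' - D = principal c⁻¹ ↔ D.1 = D'.1 + principalFin c ∧
      |((c : ℚ) : ℝ)| * Real.exp D.2 = Real.exp D'.2 := by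
  have hc : 0 < |((c : ℚ) : ℝ)| := abs_pos.2 (by exact_mod_cast c.ne_zero)
  rw [Prod.ext_iff]
  refine and_congr ?_ ?_
  · change D'.1 - D.1 = principalFin c⁻¹ ↔ _
    rw [principalFin_inv, sub_eq_iff_eq_add, neg_add_eq_sub, eq_sub_iff_add_eq, eq_comm]
  · change D'.2 - D.2 = -Real.log |(((c⁻¹ : ℚˣ) : ℚ) : ℝ)| ↔ _
    rw [Units.val_inv_eq_inv_val, Rat.cast_inv, abs_inv, Real.log_inv, neg_neg,
      sub_eq_iff_eq_add, ← Real.exp_eq_exp, Real.exp_add, Real.exp_log hc, eq_comm]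

theorem principallyEquivalent_iff_nonempty_iso (D D' : ArakelovDivisor) :
    PrincipallyEquivalent D D' ↔ Nonempty (sheafO D ≅ sheafO D') := by
  rw [PrincipallyEquivalent, inv_surjective.exists]
  refine Iff.trans (exists_congr fun c => ?_) nonempty_normSheaf_iso_iff.symm
  rw [sub_eq_principal_inv_iff,
    forall_rat_mem_Iic_iff_mul_mem_Iic (Real.exp_pos D.2) (Real.exp_pos D'.2)]

/-- The sheaf of modules defined like `O(D)`, with the strict inequality `∑ |φ(i)| < e ^ a`. -/
noncomputable def strictSheafO (D : ArakelovDivisor) : SheafOfSMod structSheaf :=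
  normSheaf D.1 (LowerSet.Iio (Real.exp D.2)) (LowerSet.mem_Iio_iff.2 (Real.exp_pos D.2))

theorem isProductBound_exp {D D' : ArakelovDivisor} (h : ¬ Exceptional D D') :
    IsProductBound (LowerSet.Iic (Real.exp D.2)) (LowerSet.Iic (Real.exp D'.2))
      (LowerSet.Iic (Real.exp (D + D').2)) := by
  rw [Prod.snd_add, Real.exp_add]
  exact isProductBound_Iic (Real.exp_pos _) (Real.exp_pos _) h

/-- The isomorphism `O(D) ∧ O(D') ≅ O(D + D')` induced by the product of `ℚ`. -/
noncomputable def smashIsoOfNotExceptional {D D' : ArakelovDivisor} (h : ¬ Exceptional D D') :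
    SheafOfSMod.smash (sheafO D) (sheafO D') ≅ sheafO (D + D') :=
  smashIso _ _ _ D.1 D'.1 (isProductBound_exp h)

theorem smashIsoOfNotExceptional_smashSec {D D' : ArakelovDivisor} (h : ¬ Exceptional D D')
    {U : Opens SpecZBar} {m n k : GammaOp} (x : ((sheafO D).obj.obj U).obj m)
    (y : ((sheafO D').obj.obj U).obj n) (v : SmashMap m n k) :
    evalAt (PresheafOfSMod.Hom.app (smashIsoOfNotExceptional h).hom.hom U)
      (SheafOfSMod.smashSec x y v) = mulSec x y v :=
  smashIso_smashSec _ _ _ (isProductBound_exp h) x y v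

theorem nonempty_smash_iso_strictSheafO {D D' : ArakelovDivisor} (h : Exceptional D D') :
    Nonempty (SheafOfSMod.smash (sheafO D) (sheafO D') ≅ strictSheafO (D + D')) := by
  refine ⟨smashIso _ _ _ D.1 D'.1 ?_⟩
  rw [Prod.snd_add, Real.exp_add]
  exact isProductBound_Iic_of_irrational (Real.exp_pos _) h.1

theorem nonempty_smash_sheafEps_iso_strictSheafO (D : ArakelovDivisor) :
    Nonempty (SheafOfSMod.smash sheafEps (sheafO D) ≅ strictSheafO D) := by
  have h := isProductBound_Iio_Iic (l := 1) (Real.exp_pos D.2)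
  rw [one_mul] at h
  have e := smashIso (zero_lt_one (α := ℝ)) (Real.exp_nonneg _)
    (LowerSet.mem_Iio_iff.2 (Real.exp_pos D.2)) 0 D.1 h
  rw [zero_add] at e
  exact ⟨e⟩

theorem nonempty_smash_iso_strictSheafO_of_sheafEps (D : ArakelovDivisor) :
    Nonempty (SheafOfSMod.smash (sheafO D) sheafEps ≅ strictSheafO D) := by
  have h := isProductBound_Iic_Iio (m := 1) (Real.exp_pos D.2) one_pos
  rw [mul_one] at h
  have e := smashIso (Real.exp_nonneg _) (zero_lt_one (α := ℝ))
    (LowerSet.mem_Iio_iff.2 (Real.exp_pos D.2)) D.1 0 h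
  rw [add_zero] at e
  exact ⟨e⟩

theorem isEmpty_smash_iso {D D' : ArakelovDivisor} (h : Exceptional D D') :
    IsEmpty (SheafOfSMod.smash (sheafO D) (sheafO D') ≅ sheafO (D + D')) := by
  obtain ⟨e⟩ := nonempty_smash_iso_strictSheafO h
  have hrat : ¬ Irrational (Real.exp (D + D').2) := by
    rw [Prod.snd_add, Real.exp_add]
    exact h.2.2
  exact ⟨fun e' => (isEmpty_normSheaf_iso_Iio_Iic _ _ _ _ hrat).false (e.symm ≪≫ e')⟩

end GammaArith

theorem mainTheorem4 :
    -- (i), the general case: the canonical morphism induced by the product is an isomorphism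
    (∀ D D' : ArakelovDivisor, ¬ Exceptional D D' →
      ∃ e : SheafOfSMod.smash (sheafO D) (sheafO D') ≅ sheafO (D + D'),
        ∀ (U : Opens SpecZBar) (m n k : GammaOp) (x : ((sheafO D).obj.obj U).obj m)
          (y : ((sheafO D').obj.obj U).obj n) (v : SmashMap m n k),
          evalAt (PresheafOfSMod.Hom.app e.hom.hom U) (SheafOfSMod.smashSec x y v) =
            mulSec x y v) ∧
    -- (i), the exceptional case
    (∀ D D' : ArakelovDivisor, Exceptional D D' →
      IsEmpty (SheafOfSMod.smash (sheafO D) (sheafO D') ≅ sheafO (D + D')) ∧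
      Nonempty (SheafOfSMod.smash (sheafO D) (sheafO D') ≅
        SheafOfSMod.smash sheafEps (sheafO (D + D'))) ∧
      Nonempty (SheafOfSMod.smash sheafEps (sheafO (D + D')) ≅
        SheafOfSMod.smash (sheafO (D + D')) sheafEps)) ∧
    -- (ii)
    (∀ D D' : ArakelovDivisor,
      PrincipallyEquivalent D D' ↔ Nonempty (sheafO D ≅ sheafO D')) := by
  refine ⟨fun D D' h => ⟨smashIsoOfNotExceptional h,
    fun _ _ _ _ => smashIsoOfNotExceptional_smashSec h⟩, fun D D' h => ?_,
    principallyEquivalent_iff_nonempty_iso⟩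
  obtain ⟨e⟩ := nonempty_smash_iso_strictSheafO h
  obtain ⟨eps_smash⟩ := nonempty_smash_sheafEps_iso_strictSheafO (D + D')
  obtain ⟨smash_eps⟩ := nonempty_smash_iso_strictSheafO_of_sheafEps (D + D')
  exact ⟨isEmpty_smash_iso h, ⟨e ≪≫ eps_smash.symm⟩, ⟨eps_smash ≪≫ smash_eps.symm⟩⟩
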